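/- Let the maximum 2-edge-colorable subgraph problem be the following search problem: given a finite simple graph $G$, find a 2-edge-colorable subgraph of $G$ with the maximum number of edges, together with a 2-edge-coloring of it (a graph is 2-edge-colorable if its edges can be assigned colors from a set of two colors so that distinct edges sharing a vertex receive different colors). Let $\nu(G)$ be the matching number of $G$, that is, the largest number of edges in a matching of $G$. Then the maximum 2-edge-colorable subgraph problem is fixed-parameter tractable with respect to $\nu(G)$: there are a deterministic algorithm, a computable function $f:\mathbb{N}\to\mathbb{N}$ and a polynomial $p$ such that the algorithm solves the problem exactly on every finite simple graph $G$ in at most $f(\nu(G))\cdot p(\mathrm{size}(G))$ steps, where $\mathrm{size}(G)$ is the length of the input (the number of vertices together with the adjacency matrix of $G$). -/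

import Mathlib

/-! ### A random access machine with a step count -/

namespace RAM

/-- The memory of the machine: finitely many arrays of natural numbers are used by a program, and
`s a i` is the content of cell `i` of the array named `a`. (A scalar variable is a cell `s a 0`.) -/
abbrev Store : Type := ℕ → ℕ → ℕ

/-- Arithmetic expressions: constants, memory reads (array name fixed by the program, index
computed), addition, and truncated subtraction. There is no multiplication, as it would make unit
cost unreasonable; with these operations a number written within `t` steps has `O(t + L)` bits,
`L` the bit length of the largest number in the input, so that unit cost is polynomially related to
the running time of a Turing machine. -/
inductive Expr : Type
  | const (k : ℕ)
  | read (a : ℕ) (i : Expr)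
  | plus (x y : Expr)
  | minus (x y : Expr)

/-- The value of an expression. -/
def Expr.val (s : Store) : Expr → ℕ
  | .const k => k
  | .read a i => s a (i.val s)
  | .plus x y => x.val s + y.val s
  | .minus x y => x.val s - y.val s

/-- The number of steps needed to evaluate an expression: one for each elementary operation. -/
def Expr.cost : Expr → ℕ
  | .const _ => 1
  | .read _ i => i.cost + 1
  | .plus x y => x.cost + y.cost + 1
  | .minus x y => x.cost + y.cost + 1

/-- Programs. A test succeeds when the value of the expression is nonzero. -/
inductive Program : Type
  | skip
  /-- write the value of `x` into the cell of array `a` whose index is the value of `i` -/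
  | write (a : ℕ) (i x : Expr)
  | seq (P Q : Program)
  /-- if `b` then `P` else `Q` -/
  | branch (b : Expr) (P Q : Program)
  /-- while `b` do `P` -/
  | loop (b : Expr) (P : Program)

/-- `Exec P s t s'`: the program `P`, started on the memory `s`, halts after exactly `t` steps,
with the memory `s'`. -/
inductive Exec : Program → Store → ℕ → Store → Prop
  | skip (s : Store) : Exec .skip s 1 s
  | write (a : ℕ) (i x : Expr) (s : Store) :
      Exec (.write a i x) s (i.cost + x.cost + 1)
        (Function.update s a (Function.update (s a) (i.val s) (x.val s)))
  | seq {P Q : Program} {s₀ s₁ s₂ : Store} {t₁ t₂ : ℕ} :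
      Exec P s₀ t₁ s₁ → Exec Q s₁ t₂ s₂ → Exec (.seq P Q) s₀ (t₁ + t₂) s₂
  | branch_true {b : Expr} {P Q : Program} {s s' : Store} {t : ℕ} :
      b.val s ≠ 0 → Exec P s t s' → Exec (.branch b P Q) s (b.cost + t + 1) s'
  | branch_false {b : Expr} {P Q : Program} {s s' : Store} {t : ℕ} :
      b.val s = 0 → Exec Q s t s' → Exec (.branch b P Q) s (b.cost + t + 1) s'
  | loop_true {b : Expr} {P : Program} {s₀ s₁ s₂ : Store} {t₁ t₂ : ℕ} :
      b.val s₀ ≠ 0 → Exec P s₀ t₁ s₁ → Exec (.loop b P) s₁ t₂ s₂ →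
      Exec (.loop b P) s₀ (b.cost + t₁ + t₂ + 1) s₂
  | loop_false {b : Expr} {P : Program} {s : Store} :
      b.val s = 0 → Exec (.loop b P) s (b.cost + 1) s

end RAM

/-! ### Fixed-parameter tractability -/

/-- An algorithmic (search) problem: its instances, how an instance is presented to the machine,
the length of the input, and which final memories hold a correct answer. -/
structure SearchProblem where
  Instance : Type
  input : Instance → RAM.Store
  size : Instance → ℕ
  IsAnswer : Instance → RAM.Store → Prop

/-- The problem `A` is fixed-parameter tractable with respect to the parameter `κ`: one program
solves every instance `I` exactly, within `f (κ I) * p (size I)` steps, where `f` is a computable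
function and `p` a polynomial. (The program is not told the value of `κ`.) -/
def SearchProblem.IsFPT (A : SearchProblem) (κ : A.Instance → ℕ) : Prop :=
  ∃ P : RAM.Program, ∃ f : ℕ → ℕ, Computable f ∧ ∃ p : Polynomial ℕ,
    ∀ I : A.Instance, ∃ (t : ℕ) (s : RAM.Store),
      RAM.Exec P (A.input I) t s ∧ t ≤ f (κ I) * p.eval (A.size I) ∧ A.IsAnswer I s

/-! ### The maximum 2-edge-colorable subgraph problem -/

/-- A graph is `k`-edge-colorable if its edges can be assigned colors from a set of `k` colors so
that distinct edges sharing a vertex receive different colors. -/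
def SimpleGraph.EdgeColorable {V : Type*} (G : SimpleGraph V) (k : ℕ) : Prop :=
  G.lineGraph.Colorable k

/-- `H` is a maximum `k`-edge-colorable subgraph of `G`. (Vertices play no role, so that `H` is
taken on all vertices of `G`.) -/
def SimpleGraph.IsMaxEdgeColorableSubgraph {V : Type*} (G : SimpleGraph V) (k : ℕ)
    (H : SimpleGraph V) : Prop :=
  H ≤ G ∧ H.EdgeColorable k ∧
    ∀ H' : SimpleGraph V, H' ≤ G → H'.EdgeColorable k → H'.edgeSet.ncard ≤ H.edgeSet.ncard

/-- The matching number `ν(G)`: the largest number of edges of a matching of `G`. -/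
noncomputable def SimpleGraph.matchingNumber {V : Type*} (G : SimpleGraph V) : ℕ :=
  sSup {k : ℕ | ∃ M : G.Subgraph, M.IsMatching ∧ M.edgeSet.ncard = k}

open Classical in
/-- The memory that holds the graph `G` on the vertices `0, …, n - 1`: cell `0` of array `0` is the
number `n` of vertices, and array `1` is the adjacency matrix, row by row. All else is `0`. -/
noncomputable def graphInput {n : ℕ} (G : SimpleGraph (Fin n)) : RAM.Store := fun a k =>
  if a = 0 ∧ k = 0 then n
  else if a = 1 ∧ ∃ i j : Fin n, G.Adj i j ∧ k = i.val * n + j.val then 1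
  else 0

/-- The final memory `s` holds in array `2`, as an `n × n` matrix written row by row, the graph `H`
together with the edge coloring `c`: the entry `(i, j)` is `0` if `ij` is not an edge of `H`, and
`1` or `2`, according to the color of `ij`, if it is. -/
def HoldsColoring {n : ℕ} (s : RAM.Store) (H : SimpleGraph (Fin n))
    (c : H.lineGraph.Coloring (Fin 2)) : Prop :=
  ∀ i j : Fin n,
    (¬ H.Adj i j → s 2 (i.val * n + j.val) = 0) ∧
    ∀ h : H.Adj i j, s 2 (i.val * n + j.val) = (c ⟨s(i, j), h⟩).val + 1

/-- The maximum 2-edge-colorable subgraph problem: given a finite simple graph `G`, find a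
2-edge-colorable subgraph with the maximum number of edges, together with a 2-edge-coloring of it.
The length of the input is the number of cells it occupies. -/
noncomputable def maxTwoEdgeColorableSubgraph : SearchProblem where
  Instance := Σ n : ℕ, SimpleGraph (Fin n)
  input I := graphInput I.2
  size I := I.1 * I.1 + 1
  IsAnswer I s := ∃ H : SimpleGraph (Fin I.1), I.2.IsMaxEdgeColorableSubgraph 2 H ∧
    ∃ c : H.lineGraph.Coloring (Fin 2), HoldsColoring s H c

/-! The vertices of a maximal matching with `μ ≤ ν(G)` edges form a vertex cover `X` with `|X| =
2μ`. A 2-edge-colored subgraph has at most two edges at each vertex of `X`, hence at most `2|X|`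
edges, and these touch at most `4|X|` vertices.

At every `x ∈ X` it is therefore enough to consider `K = 4|X| + 1 = 8μ + 1` edges, or all edges if
there are fewer. Suppose that an optimal solution uses an edge `xy` that is not listed. Then `K`
neighbors of `x` are listed, and one of them, `z`, is not touched by the solution. Replacing `xy` by
`xz` in the same color keeps the coloring proper and the number of edges, and leaves fewer unlisted
edges. Iterating yields an optimal solution with listed edges only (`IsTable.exists_listed`).

Pairs of a listed edge and a color are called items; there are `m ≤ 2K|X| = 32μ² + 4μ` of them. The
program runs through all `2 ^ m` sets of items. For each it adds the items one by one, skipping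
those in conflict, so that every set produces a legal solution (`IsTable.tryEdge`), and the set
belonging to the optimal solution is never obstructed (`tryEdge_subtable`). The best result is kept
(`run_search`).

A colored subgraph is stored as a table with one cell for each vertex and color. Each edge fills two
cells, so that maximizing edges means maximizing nonzero cells (`card_usedCells_eq`). Correctness
and running time are proved together, by a Hoare-style calculus for `Run`. -/

namespace RAM

/-! ### Program logic with time bounds -/

/-- The arrays a program may write to. -/
def Program.writes : Program → List ℕ
  | .skip => []
  | .write a _ _ => [a]
  | .seq P Q => P.writes ++ Q.writes
  | .branch _ P Q => P.writes ++ Q.writes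
  | .loop _ P => P.writes

theorem Exec.frame {P : Program} {s s' : Store} {t : ℕ} (h : Exec P s t s') :
    ∀ a, a ∉ P.writes → s' a = s a := by
  induction h with
  | skip => intros; rfl
  | write a i x s =>
    intro b hb
    simp only [Program.writes, List.mem_singleton] at hb
    simp [Function.update_of_ne hb]
  | seq _ _ ih₁ ih₂ =>
    intro a ha
    simp only [Program.writes, List.mem_append, not_or] at ha
    rw [ih₂ a ha.2, ih₁ a ha.1]
  | branch_true _ _ ih =>
    intro a ha
    simp only [Program.writes, List.mem_append, not_or] at ha
    exact ih a ha.1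
  | branch_false _ _ ih =>
    intro a ha
    simp only [Program.writes, List.mem_append, not_or] at ha
    exact ih a ha.2
  | loop_true _ _ _ ih₁ ih₂ =>
    intro a ha
    rw [ih₂ a ha, ih₁ a ha]
  | loop_false => intros; rfl

/-- Started on `s`, the program `P` halts within `T` steps in a memory that satisfies `Q`. -/
def Run (P : Program) (s : Store) (T : ℕ) (Q : Store → Prop) : Prop :=
  ∃ (t : ℕ) (s' : Store), Exec P s t s' ∧ t ≤ T ∧ Q s'

theorem Run.mono {P : Program} {s : Store} {T T' : ℕ} {Q Q' : Store → Prop}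
    (h : Run P s T Q) (hT : T ≤ T') (hQ : ∀ s', Q s' → Q' s') : Run P s T' Q' := by
  obtain ⟨t, s', he, ht, hq⟩ := h
  exact ⟨t, s', he, ht.trans hT, hQ s' hq⟩

/-- Like `Run.mono`, where the arrays that `P` does not write to are known to be unchanged. -/
theorem Run.monoFrame {P : Program} {s : Store} {T T' : ℕ} {Q Q' : Store → Prop}
    (h : Run P s T Q) (hT : T ≤ T')
    (hQ : ∀ s', (∀ a, a ∉ P.writes → s' a = s a) → Q s' → Q' s') : Run P s T' Q' := by
  obtain ⟨t, s', he, ht, hq⟩ := h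
  exact ⟨t, s', he, ht.trans hT, hQ s' he.frame hq⟩

theorem Run.skip {s : Store} {T : ℕ} {Q : Store → Prop} (hT : 1 ≤ T) (hQ : Q s) :
    Run .skip s T Q :=
  ⟨1, s, .skip s, hT, hQ⟩

theorem Run.write {a : ℕ} {i x : Expr} {s : Store} {T : ℕ} {Q : Store → Prop}
    (hT : i.cost + x.cost + 1 ≤ T)
    (hQ : Q (Function.update s a (Function.update (s a) (i.val s) (x.val s)))) :
    Run (.write a i x) s T Q :=
  ⟨_, _, .write a i x s, hT, hQ⟩

theorem Run.seq {P R : Program} {s : Store} {T : ℕ} {Q : Store → Prop} (T₁ T₂ : ℕ)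
    (hT : T₁ + T₂ ≤ T) (h : Run P s T₁ (fun s' => Run R s' T₂ Q)) :
    Run (.seq P R) s T Q := by
  obtain ⟨t₁, s₁, h₁, ht₁, t₂, s₂, h₂, ht₂, hq⟩ := h
  exact ⟨_, s₂, .seq h₁ h₂, by omega, hq⟩

theorem Run.branch {b : Expr} {P R : Program} {s : Store} {T : ℕ} {Q : Store → Prop} (T₁ : ℕ)
    (hT : b.cost + T₁ + 1 ≤ T) (h₁ : b.val s ≠ 0 → Run P s T₁ Q)
    (h₂ : b.val s = 0 → Run R s T₁ Q) : Run (.branch b P R) s T Q := by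
  by_cases hb : b.val s = 0
  · obtain ⟨t, s', he, ht, hq⟩ := h₂ hb
    exact ⟨_, s', .branch_false hb he, by omega, hq⟩
  · obtain ⟨t, s', he, ht, hq⟩ := h₁ hb
    exact ⟨_, s', .branch_true hb he, by omega, hq⟩

/-- The scalar variable `a`. -/
abbrev Expr.var (a : ℕ) : Expr := .read a (.const 0)

/-- Assignment to a scalar variable. -/
abbrev Program.assign (a : ℕ) (x : Expr) : Program := .write a (.const 0) x

/-- Run `P` for all values of the scalar variable `v` below the value of the scalar
variable `b`. -/
def Program.for (v b : ℕ) (P : Program) : Program :=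
  .seq (.assign v (.const 0))
    (.loop (.minus (.var b) (.var v)) (.seq P (.assign v (.plus (.var v) (.const 1)))))

/-- The overhead of 12 per round is 6 for the test and 6 for the increment; the 9 outside is 3 for
the initialization and 6 for the last, failing test. By `hI` the invariant may not depend on the
loop variable, whose value is supplied separately to `hs`; thus the increment preserves it for free.
-/
theorem Run.for {v b : ℕ} {P : Program} {s₀ : Store} {N T T' : ℕ} {Q : Store → Prop}
    (Inv : ℕ → Store → Prop) (hb : s₀ b 0 = N) (hT : N * (T + 12) + 9 ≤ T')
    (hv : v ∉ P.writes) (hbw : b ∉ v :: P.writes)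
    (hI : ∀ k s x, Inv k s → Inv k (Function.update s v x))
    (h₀ : Inv 0 s₀)
    (hs : ∀ k s, k < N → s v 0 = k → (∀ a, a ∉ v :: P.writes → s a = s₀ a) → Inv k s →
      Run P s T (Inv (k + 1)))
    (hQ : ∀ s, (∀ a, a ∉ v :: P.writes → s a = s₀ a) → Inv N s → Q s) :
    Run (.for v b P) s₀ T' Q := by
  have key : ∀ m k s, k + m = N → s v 0 = k → (∀ a, a ∉ v :: P.writes → s a = s₀ a) → Inv k s →
      Run (.loop (.minus (.var b) (.var v)) (.seq P (.assign v (.plus (.var v) (.const 1)))))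
        s (m * (T + 12) + 6) Q := by
    intro m
    induction m with
    | zero =>
      intro k s hk hsv hf hinv
      refine ⟨_, s, .loop_false ?_, ?_, hQ s hf (by simpa [← hk] using hinv)⟩
      · simp only [Expr.val, hsv, hf b hbw, hb]; omega
      · simp [Expr.cost]
    | succ m ih =>
      intro k s hk hsv hf hinv
      obtain ⟨t, s₁, he, ht, hinv₁⟩ := hs k s (by omega) hsv hf hinv
      have hf₁ := he.frame
      have hsv₁ : s₁ v 0 = k := by rw [hf₁ v hv, hsv]
      obtain ⟨t₂, s₂, he₂, ht₂, hq⟩ := ih (k + 1)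
        (Function.update s₁ v (Function.update (s₁ v) 0 (k + 1))) (by omega) (by simp)
        (by
          intro a ha
          rw [Function.update_of_ne (fun h => ha (by simp [h]))]
          rw [hf₁ a (fun h => ha (List.mem_cons_of_mem _ h)), hf a ha])
        (hI _ _ _ hinv₁)
      have hw := Exec.write v (.const 0) (.plus (.var v) (.const 1)) s₁
      simp only [Expr.val, hsv₁] at hw
      refine ⟨_, s₂, .loop_true ?_ (.seq he hw) he₂, ?_, hq⟩
      · simp only [Expr.val, hsv, hf b hbw, hb]; omega
      · simp only [Expr.cost]
        have : (m + 1) * (T + 12) = m * (T + 12) + (T + 12) := by ring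
        omega
  refine Run.seq 3 (N * (T + 12) + 6) (by omega) (Run.write (by simp [Expr.cost]) ?_)
  refine key N 0 _ (by omega) (by simp [Expr.val]) ?_ (hI _ _ _ h₀)
  intro a ha
  rw [Function.update_of_ne (fun h => ha (by simp [h]))]

end RAM

/-! ### Edge-colored subgraphs as tables -/

/-- Adjacency of vertices given as natural numbers. -/
def SimpleGraph.AdjNat {n : ℕ} (G : SimpleGraph (Fin n)) (u v : ℕ) : Prop :=
  ∃ (hu : u < n) (hv : v < n), G.Adj ⟨u, hu⟩ ⟨v, hv⟩

theorem SimpleGraph.AdjNat.symm {n : ℕ} {G : SimpleGraph (Fin n)} {u v : ℕ}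
    (h : G.AdjNat u v) : G.AdjNat v u :=
  let ⟨hu, hv, h⟩ := h; ⟨hv, hu, h.symm⟩

theorem SimpleGraph.AdjNat.ne {n : ℕ} {G : SimpleGraph (Fin n)} {u v : ℕ}
    (h : G.AdjNat u v) : u ≠ v := by
  obtain ⟨hu, hv, h⟩ := h
  rintro rfl
  exact h.ne rfl

/-- The array `p` describes a subgraph with a proper 2-edge-coloring: if `uv` is an edge of color
`c` then cell `2 * u + c` holds `v + 1`; it holds `0` if there is no edge of color `c` at `u`. -/
def IsTable (A : ℕ → ℕ → Prop) (p : ℕ → ℕ) : Prop :=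
  ∀ u c v, c < 2 → p (2 * u + c) = v + 1 →
    A u v ∧ p (2 * v + c) = u + 1 ∧ p (2 * u + (1 - c)) ≠ v + 1

/-- The nonzero cells of an array among the first `2 * n` ones. -/
def usedCells (n : ℕ) (p : ℕ → ℕ) : Finset ℕ := {k ∈ Finset.range (2 * n) | p k ≠ 0}

theorem mem_usedCells {n : ℕ} {p : ℕ → ℕ} {k : ℕ} :
    k ∈ usedCells n p ↔ k < 2 * n ∧ p k ≠ 0 := by
  simp [usedCells]

theorem card_usedCells_le (n : ℕ) (p : ℕ → ℕ) : (usedCells n p).card ≤ 2 * n := by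
  exact (Finset.card_filter_le _ _).trans (Finset.card_range _).le

theorem isTable_zero (A : ℕ → ℕ → Prop) : IsTable A (fun _ => 0) := by
  intro u c v _ h
  simp at h

theorem IsTable.at {A : ℕ → ℕ → Prop} {p : ℕ → ℕ} (hp : IsTable A p) {k v : ℕ}
    (h : p k = v + 1) : A (k / 2) v ∧ p (2 * v + k % 2) = k / 2 + 1 := by
  have := hp (k / 2) (k % 2) v (Nat.mod_lt _ two_pos) (by rwa [Nat.div_add_mod])
  exact ⟨this.1, this.2.1⟩

/-- Nonzero cells correspond to darts of `H`, of which there are two for each edge. Injectivity is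
the last clause of `IsTable`: two cells with the same dart would give one edge both colors. -/
theorem card_usedCells_eq {n : ℕ} {G H : SimpleGraph (Fin n)} {p : ℕ → ℕ}
    (hp : IsTable G.AdjNat p)
    (hH : ∀ u v : Fin n, H.Adj u v ↔ ∃ c < 2, p (2 * u + c) = v + 1) :
    (usedCells n p).card = 2 * H.edgeSet.ncard := by
  classical
  have h1 : H.edgeSet.ncard = H.edgeFinset.card := by
    rw [← SimpleGraph.coe_edgeFinset, Set.ncard_coe_finset]
  rw [h1, SimpleGraph.two_mul_card_edgeFinset]
  have hk : ∀ k ∈ usedCells n p, ∃ v, p k = v + 1 ∧ k / 2 < n ∧ v < n := by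
    intro k hk
    rw [mem_usedCells] at hk
    obtain ⟨v, hv⟩ := Nat.exists_eq_succ_of_ne_zero hk.2
    obtain ⟨hu', hv', -⟩ := (hp.at hv).1
    exact ⟨v, hv, hu', hv'⟩
  refine Finset.card_bij (fun k h => (⟨k / 2, ?_⟩, ⟨p k - 1, ?_⟩)) ?_ ?_ ?_
  · obtain ⟨v, h1, h2, h3⟩ := hk k h
    exact h2
  · obtain ⟨v, h1, h2, h3⟩ := hk k h
    omega
  · intro k h
    obtain ⟨v, h1, h2, h3⟩ := hk k h
    simp only [Finset.mem_filter, Finset.mem_univ, true_and, hH]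
    exact ⟨k % 2, Nat.mod_lt _ two_pos, by rw [Nat.div_add_mod]; omega⟩
  · intro k h k' h' e
    obtain ⟨v, h1, -, -⟩ := hk k h
    obtain ⟨v', h1', -, -⟩ := hk k' h'
    simp only [Prod.mk.injEq, Fin.mk.injEq] at e
    by_contra hne
    refine (hp (k / 2) (k % 2) v (Nat.mod_lt _ two_pos) (by rwa [Nat.div_add_mod])).2.2 ?_
    have : 2 * (k / 2) + (1 - k % 2) = k' := by omega
    rw [this]; omega
  · rintro ⟨u, v⟩ h
    simp only [Finset.mem_filter, Finset.mem_univ, true_and, hH] at h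
    obtain ⟨c, hc, h⟩ := h
    have hu := u.2
    refine ⟨2 * u + c, mem_usedCells.2 ⟨by omega, by omega⟩, ?_⟩
    ext
    · simp; omega
    · simp [h]

theorem exists_table_of_edgeColorable {n : ℕ} {G H : SimpleGraph (Fin n)} (hHG : H ≤ G)
    (hH : H.EdgeColorable 2) :
    ∃ p, IsTable G.AdjNat p ∧ (usedCells n p).card = 2 * H.edgeSet.ncard := by
  classical
  obtain ⟨col⟩ := hH
  let R : ℕ → ℕ → Prop := fun k v => ∃ (hu : k / 2 < n) (hv : v < n)
    (h : H.Adj ⟨k / 2, hu⟩ ⟨v, hv⟩), (col ⟨s(⟨k / 2, hu⟩, ⟨v, hv⟩), h⟩).val = k % 2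
  -- Two different edges of the same color at a common vertex would be adjacent in the line graph.
  have huniq : ∀ k v v', R k v → R k v' → v = v' := by
    rintro k v v' ⟨hu, hv, h, e⟩ ⟨_, hv', h', e'⟩
    by_contra hne
    refine col.valid (v := ⟨s(⟨k / 2, hu⟩, ⟨v, hv⟩), h⟩) (w := ⟨s(⟨k / 2, hu⟩, ⟨v', hv'⟩), h'⟩) ?_
      (Fin.ext (e.trans e'.symm))
    rw [SimpleGraph.lineGraph_adj_iff_exists]
    refine ⟨?_, ⟨k / 2, hu⟩, by simp, by simp⟩
    intro he
    have he := congrArg Subtype.val he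
    simp at he
    omega
  let p : ℕ → ℕ := fun k => if h : ∃ v, R k v then h.choose + 1 else 0
  have hpR : ∀ k v, p k = v + 1 ↔ R k v := by
    intro k v
    by_cases h : ∃ v, R k v
    · simp only [p, dif_pos h, Nat.add_right_cancel_iff]
      constructor
      · rintro rfl
        exact h.choose_spec
      · exact fun h' => huniq k _ _ h.choose_spec h'
    · simp only [p, dif_neg h]
      exact ⟨fun h' => by omega, fun h' => (h ⟨v, h'⟩).elim⟩
  have hR : ∀ u c v, c < 2 → (R (2 * u + c) v ↔ ∃ (hu : u < n) (hv : v < n)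
      (h : H.Adj ⟨u, hu⟩ ⟨v, hv⟩), (col ⟨s(⟨u, hu⟩, ⟨v, hv⟩), h⟩).val = c) := by
    intro u c v hc
    have h1 : (2 * u + c) / 2 = u := by omega
    have h2 : (2 * u + c) % 2 = c := by omega
    simp only [R, h1, h2]
  have hp : IsTable G.AdjNat p := by
    intro u c v hc h
    rw [hpR, hR _ _ _ hc] at h
    rw [hpR, ne_eq, hpR, hR _ _ _ hc, hR _ _ _ (by omega)]
    obtain ⟨hu, hv, h, e⟩ := h
    refine ⟨⟨hu, hv, hHG h⟩, ⟨hv, hu, h.symm, ?_⟩, ?_⟩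
    · rw [← e]
      congr 3
      exact Sym2.eq_swap
    · rintro ⟨_, _, _, e'⟩
      omega
  refine ⟨p, hp, card_usedCells_eq hp ?_⟩
  intro u v
  constructor
  · intro h
    exact ⟨(col ⟨s(u, v), h⟩).val, (col ⟨s(u, v), h⟩).2, by
      rw [hpR, hR _ _ _ (col ⟨s(u, v), h⟩).2]
      exact ⟨u.2, v.2, h, rfl⟩⟩
  · rintro ⟨c, hc, h⟩
    rw [hpR, hR _ _ _ hc] at h
    obtain ⟨_, _, h, _⟩ := h
    exact h

/-- The entry of the output matrix in row `u` and column `v`. -/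
def tableEntry (p : ℕ → ℕ) (u v : ℕ) : ℕ :=
  if p (2 * u) = v + 1 then 1 else if p (2 * u + 1) = v + 1 then 2 else 0

theorem IsTable.exists_coloring {n : ℕ} {G : SimpleGraph (Fin n)} {p : ℕ → ℕ}
    (hp : IsTable G.AdjNat p) {s : RAM.Store}
    (hs : ∀ u v, u < n → v < n → s 2 (u * n + v) = tableEntry p u v) :
    ∃ H ≤ G, 2 * H.edgeSet.ncard = (usedCells n p).card ∧
      ∃ c : H.lineGraph.Coloring (Fin 2), HoldsColoring s H c := by
  classical
  have hsymm : ∀ u v c, c < 2 → (p (2 * u + c) = v + 1 ↔ p (2 * v + c) = u + 1) :=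
    fun u v c hc => ⟨fun h => (hp u c v hc h).2.1, fun h => (hp v c u hc h).2.1⟩
  let H : SimpleGraph (Fin n) :=
    { Adj := fun u v => ∃ c < 2, p (2 * u + c) = v + 1
      symm := ⟨fun u v ⟨c, hc, h⟩ => ⟨c, hc, (hsymm _ _ _ hc).1 h⟩⟩
      loopless := ⟨fun u ⟨c, hc, h⟩ => (hp _ _ _ hc h).1.ne rfl⟩ }
  have hcol : ∀ u v : Fin n, p (2 * u) = v + 1 ↔ p (2 * v) = u + 1 :=
    fun u v => hsymm u v 0 two_pos
  let f : Sym2 (Fin n) → Fin 2 := Sym2.lift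
    ⟨fun u v => if p (2 * u) = v + 1 then 0 else 1, fun u v => by simp only [hcol u v]⟩
  have hf : ∀ (u v : Fin n) c, c < 2 → p (2 * u + c) = v + 1 → (f s(u, v)).val = c := by
    intro u v c hc h
    simp only [f, Sym2.lift_mk]
    interval_cases c
    · rw [if_pos (by simpa using h)]; rfl
    · rw [if_neg (by simpa using (hp _ _ _ one_lt_two h).2.2)]; rfl
  have hf' : ∀ (u v : Fin n), H.Adj u v → p (2 * u + (f s(u, v)).val) = v + 1 := by
    rintro u v ⟨c, hc, h⟩
    rw [hf u v c hc h, h]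
  let col : H.lineGraph.Coloring (Fin 2) := SimpleGraph.Coloring.mk (fun e => f e.1) (by
    rintro ⟨e, he⟩ ⟨e', he'⟩ hadj heq
    rw [SimpleGraph.lineGraph_adj_iff_exists] at hadj
    obtain ⟨hne, w, hw, hw'⟩ := hadj
    obtain ⟨v, rfl⟩ := Sym2.mem_iff_exists.1 hw
    obtain ⟨v', rfl⟩ := Sym2.mem_iff_exists.1 hw'
    have h1 := hf' w v he
    have h2 := hf' w v' he'
    simp only at heq
    rw [heq, h2] at h1
    refine hne (Subtype.ext ?_)
    have : v = v' := Fin.ext (by omega)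
    simp only [this])
  refine ⟨H, ?_, (card_usedCells_eq hp fun u v => Iff.rfl).symm, col, ?_⟩
  · rintro u v ⟨c, hc, h⟩
    obtain ⟨_, _, h⟩ := (hp _ _ _ hc h).1
    exact h
  · intro u v
    rw [hs u v u.2 v.2, tableEntry]
    constructor
    · intro h
      rw [if_neg (fun h' : p (2 * u) = v + 1 => h ⟨0, two_pos, h'⟩), if_neg (fun h' => h ⟨1, one_lt_two, h'⟩)]
    · rintro ⟨c, hc, h⟩
      have hfc : (col ⟨s(u, v), ⟨c, hc, h⟩⟩).val = c := hf u v c hc h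
      rw [hfc]
      interval_cases c
      · rw [if_pos (by simpa using h)]
      · rw [if_neg (by simpa using (hp _ _ _ one_lt_two h).2.2), if_pos h]

theorem exists_max_table (A : ℕ → ℕ → Prop) (n : ℕ) :
    ∃ p, IsTable A p ∧ ∀ q, IsTable A q → (usedCells n q).card ≤ (usedCells n p).card := by
  let S : Set ℕ := {m | ∃ p, IsTable A p ∧ (usedCells n p).card = m}
  have hb : BddAbove S := ⟨2 * n, by rintro _ ⟨p, -, rfl⟩; exact card_usedCells_le n p⟩
  obtain ⟨p, hp, e⟩ := Nat.sSup_mem (s := S) ⟨_, _, isTable_zero A, rfl⟩ hb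
  exact ⟨p, hp, fun q hq => e ▸ le_csSup hb ⟨q, hq, rfl⟩⟩

/-! ### The exchange argument -/

/-- The table `p` with the edge `xy` of color `c` replaced by the edge `xz` of the same color. -/
def moveEdge (p : ℕ → ℕ) (x c y z : ℕ) : ℕ → ℕ := fun k =>
  if k = 2 * x + c then z + 1 else if k = 2 * z + c then x + 1 else if k = 2 * y + c then 0 else p k

section Exchange

variable {n : ℕ} {A : ℕ → ℕ → Prop} {p : ℕ → ℕ} {x c y z : ℕ}

/-- Both cells of `z` must be empty: the one of color `c` to make room for `xz`, the other one so
that `xz` is not already present in the other color. -/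
theorem isTable_moveEdge (hA : ∀ u v, A u v → A v u) (hne : ∀ u v, A u v → u ≠ v)
    (hp : IsTable A p) (hc : c < 2) (hxy : p (2 * x + c) = y + 1) (hxz : A x z)
    (hz : ∀ c < 2, p (2 * z + c) = 0) : IsTable A (moveEdge p x c y z) := by
  have hxz' := hne x z hxz
  obtain ⟨hAxy, hyx, -⟩ := hp x c y hc hxy
  have hxy' := hne x y hAxy
  have hyz : y ≠ z := by rintro rfl; have := hz c hc; omega
  intro u d v hd h
  have hdd : d = c ∨ d = 1 - c := by omega
  have e1 : ∀ a b : ℕ, 2 * a + c = 2 * b + c ↔ a = b := by omega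
  have e2 : ∀ a b : ℕ, 2 * a + c ≠ 2 * b + (1 - c) := by omega
  have e3 : ∀ a b : ℕ, 2 * a + (1 - c) ≠ 2 * b + c := by omega
  have hcc : 1 - (1 - c) = c := by omega
  have hc1 : 1 - c < 2 := by omega
  have hz0 := hz c hc
  have hz1 := hz (1 - c) hc1
  rcases hdd with rfl | rfl
  · simp only [moveEdge, e1, e3, if_false] at h ⊢
    split_ifs at h with h1 h2 h3
    · obtain rfl : z = v := by omega
      subst h1
      refine ⟨hxz, by simp [hxz'.symm], ?_⟩
      intro h'
      have := (hp _ _ _ hc1 h').2.1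
      omega
    · obtain rfl : x = v := by omega
      subst h2
      refine ⟨hA _ _ hxz, by simp, by omega⟩
    · obtain ⟨a1, a2, a3⟩ := hp u d v hd h
      have hvx : v ≠ x := by rintro rfl; omega
      have hvz : v ≠ z := by rintro rfl; omega
      have hvy : v ≠ y := by rintro rfl; omega
      simp only [hvx, hvz, hvy, if_false]
      exact ⟨a1, a2, a3⟩
  · simp only [moveEdge, e1, e3, if_false, hcc] at h ⊢
    obtain ⟨a1, a2, a3⟩ := hp u (1 - c) v hd h
    rw [hcc] at a3
    refine ⟨a1, a2, ?_⟩
    have hvz : v ≠ z := by rintro rfl; omega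
    have huz : u ≠ z := by rintro rfl; omega
    split_ifs with h1 h2
    · omega
    · omega
    · exact a3

theorem usedCells_moveEdge (hzn : z < n) (hxy : x ≠ y) (hyz : y ≠ z) (hc : c < 2)
    (hxy' : p (2 * x + c) = y + 1) (hyx : p (2 * y + c) = x + 1) (hyn : y < n)
    (hz : p (2 * z + c) = 0) :
    (usedCells n (moveEdge p x c y z)).card = (usedCells n p).card := by
  have : usedCells n (moveEdge p x c y z) = insert (2 * z + c) ((usedCells n p).erase (2 * y + c)) := by
    ext k
    simp only [mem_usedCells, Finset.mem_insert, Finset.mem_erase, moveEdge]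
    by_cases h1 : k = 2 * x + c
    · rw [if_pos h1]; subst h1; omega
    · by_cases h2 : k = 2 * z + c
      · rw [if_neg h1, if_pos h2]; omega
      · by_cases h3 : k = 2 * y + c
        · rw [if_neg h1, if_neg h2, if_pos h3]; omega
        · simp [h1, h2, h3]
  rw [this, Finset.card_insert_of_notMem (by simp [mem_usedCells, hz]), Finset.card_erase_of_mem
    (by rw [mem_usedCells]; omega)]
  have : 0 < (usedCells n p).card := Finset.card_pos.2 ⟨2 * y + c, by rw [mem_usedCells]; omega⟩
  omega

/-- Every edge fills two cells, one of which lies at a vertex of `X`. So each used cell is one of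
the `2|X|` cells at `X` or the partner of such a cell. -/
theorem IsTable.card_usedCells_le {X : Finset ℕ} (hX : ∀ u v, A u v → u ∈ X ∨ v ∈ X)
    (hp : IsTable A p) : (usedCells n p).card ≤ 4 * X.card := by
  have hsub : usedCells n p ⊆
      ((X ×ˢ Finset.range 2).image fun q => 2 * q.1 + q.2) ∪
        ((X ×ˢ Finset.range 2).image fun q => 2 * (p (2 * q.1 + q.2) - 1) + q.2) := by
    intro k hk
    rw [mem_usedCells] at hk
    obtain ⟨v, hv⟩ := Nat.exists_eq_succ_of_ne_zero hk.2
    obtain ⟨h1, h2⟩ := hp.at hv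
    simp only [Finset.mem_union, Finset.mem_image, Finset.mem_product, Finset.mem_range, Prod.exists]
    rcases hX _ _ h1 with h | h
    · exact Or.inl ⟨k / 2, k % 2, ⟨h, by omega⟩, by omega⟩
    · exact Or.inr ⟨v, k % 2, ⟨h, by omega⟩, by rw [h2]; omega⟩
  refine (Finset.card_le_card hsub).trans ((Finset.card_union_le _ _).trans ?_)
  have h : (X ×ˢ Finset.range 2).card = 2 * X.card := by simp [mul_comm]
  have h1 := Finset.card_image_le (s := X ×ˢ Finset.range 2) (f := fun q => 2 * q.1 + q.2)
  have h2 := Finset.card_image_le (s := X ×ˢ Finset.range 2)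
    (f := fun q => 2 * (p (2 * q.1 + q.2) - 1) + q.2)
  omega

/-- If every vertex of the vertex cover `X` has many listed neighbors, or all its neighbors are
listed, then some table of the same size as `p` uses listed edges only. -/
theorem IsTable.exists_listed (hA : ∀ u v, A u v → A v u) (hne : ∀ u v, A u v → u ≠ v)
    (hn : ∀ u v, A u v → u < n) {X : Finset ℕ} (hX : ∀ u v, A u v → u ∈ X ∨ v ∈ X)
    {L : ℕ → ℕ → Prop} (hLA : ∀ u v, L u v → A u v)
    (hL : ∀ x ∈ X, ∃ S : Finset ℕ, (∀ y ∈ S, L x y) ∧ ∀ y, A x y → y ∈ S ∨ 4 * X.card < S.card)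
    (hp : IsTable A p) :
    ∃ q, IsTable A q ∧ (usedCells n q).card = (usedCells n p).card ∧
      ∀ u c v, c < 2 → q (2 * u + c) = v + 1 → L u v ∨ L v u := by
  classical
  -- The number of cells with an unlisted edge is the induction measure.
  let bad : (ℕ → ℕ) → Finset ℕ := fun q =>
    {k ∈ usedCells n q | ¬ (L (k / 2) (q k - 1) ∨ L (q k - 1) (k / 2))}
  have hbad : ∀ q k, k ∈ bad q ↔ (k < 2 * n ∧ q k ≠ 0) ∧
      ¬ (L (k / 2) (q k - 1) ∨ L (q k - 1) (k / 2)) := by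
    intro q k
    simp only [bad, Finset.mem_filter, mem_usedCells]
  induction hm : (bad p).card using Nat.strong_induction_on generalizing p with
  | _ m ih =>
  by_cases hgood : ∀ u c v, c < 2 → p (2 * u + c) = v + 1 → L u v ∨ L v u
  · exact ⟨p, hp, rfl, hgood⟩
  obtain ⟨x, c, y, hc, hxy, hnL, hxX⟩ : ∃ x c y, c < 2 ∧ p (2 * x + c) = y + 1 ∧
      ¬ (L x y ∨ L y x) ∧ x ∈ X := by
    push Not at hgood
    obtain ⟨x, c, y, hc, hxy, h1, h2⟩ := hgood
    obtain ⟨a1, a2, -⟩ := hp x c y hc hxy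
    rcases hX _ _ a1 with h | h
    · exact ⟨x, c, y, hc, hxy, by tauto, h⟩
    · exact ⟨y, c, x, hc, a2, by tauto, h⟩
  obtain ⟨hAxy, hyx, -⟩ := hp x c y hc hxy
  obtain ⟨S, hS, hS'⟩ := hL x hxX
  have hcard : 4 * X.card < S.card :=
    (hS' y hAxy).resolve_left fun h => hnL (Or.inl (hS y h))
  -- At most `4|X|` cells are used, hence at most `4|X|` vertices are touched, fewer than `S` has.
  obtain ⟨z, hzS, hz⟩ : ∃ z ∈ S, z ∉ (usedCells n p).image (· / 2) := by
    by_contra! h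
    have h1 := Finset.card_le_card (show S ⊆ (usedCells n p).image (· / 2) from h)
    have h2 := Finset.card_image_le (s := usedCells n p) (f := (· / 2))
    have h3 := hp.card_usedCells_le (n := n) hX
    omega
  have hxz := hLA _ _ (hS z hzS)
  have hzn := hn _ _ (hA _ _ hxz)
  have hz' : ∀ c < 2, p (2 * z + c) = 0 := by
    intro c hc
    by_contra h
    refine hz (Finset.mem_image.2 ⟨2 * z + c, mem_usedCells.2 ⟨by omega, h⟩, by omega⟩)
  have hyz : y ≠ z := by rintro rfl; have := hz' c hc; omega
  have hcardeq := usedCells_moveEdge (n := n) hzn (hne _ _ hAxy) hyz hc hxy hyx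
    (hn _ _ (hA _ _ hAxy)) (hz' c hc)
  -- The move creates no bad cell, as the edge `xz` is listed, and the cell of `x` stops being bad.
  have hlt : (bad (moveEdge p x c y z)).card < m := by
    rw [← hm]
    refine Finset.card_lt_card ?_
    rw [Finset.ssubset_iff_of_subset]
    · refine ⟨2 * x + c, ?_, ?_⟩
      · have e : (2 * x + c) / 2 = x := by omega
        rw [hbad, hxy, e, Nat.add_sub_cancel]
        have := hn _ _ hAxy
        exact ⟨⟨by omega, by omega⟩, hnL⟩
      · have e : (2 * x + c) / 2 = x := by omega
        simp [hbad, moveEdge, e, hS z hzS]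
    · intro k hk
      simp only [hbad, moveEdge] at hk ⊢
      by_cases h1 : k = 2 * x + c
      · have e : (2 * x + c) / 2 = x := by omega
        simp [h1, e, hS z hzS] at hk
      · by_cases h2 : k = 2 * z + c
        · have e : (2 * z + c) / 2 = z := by omega
          rw [if_neg h1, if_pos h2] at hk
          exact absurd (by rw [h2, e]; exact Or.inr (hS z hzS)) hk.2
        · by_cases h3 : k = 2 * y + c
          · rw [if_neg h1, if_neg h2, if_pos h3] at hk
            exact absurd rfl hk.1.2
          · simpa only [h1, h2, h3, if_false] using hk
  obtain ⟨q, hq, hqc, hqL⟩ := ih _ hlt (isTable_moveEdge hA hne hp hc hxy hxz hz') rfl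
  exact ⟨q, hq, hqc.trans hcardeq, hqL⟩

end Exchange

/-! ### Sets of items as binary words -/

/-- For every sequence `b` of `m` bits there is a word from which doubling brings out the bits of
`b` as carries, one after the other. -/
theorem exists_bits (b : ℕ → Prop) [DecidablePred b] (m : ℕ) :
    ∃ g : ℕ → ℕ, (∀ k ≤ m, g k < 2 ^ m) ∧
      ∀ k < m, 2 * g k = (if b k then 2 ^ m else 0) + g (k + 1) := by
  let w : ℕ → ℕ := fun i => if b (m - 1 - i) then 2 ^ i else 0
  have hw : ∀ j, ∑ i ∈ Finset.range j, w i < 2 ^ j := by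
    intro j
    induction j with
    | zero => simp
    | succ j ih =>
      rw [Finset.sum_range_succ, pow_succ]
      have : w j ≤ 2 ^ j := by simp only [w]; split_ifs <;> simp
      omega
  -- The word `g k` consists of the lowest `m - k` bits, shifted up by `k` places: the bits not yet
  -- brought out, the next one in the leading position.
  refine ⟨fun k => 2 ^ k * ∑ i ∈ Finset.range (m - k), w i, fun k hk => ?_, fun k hk => ?_⟩
  · calc _ < 2 ^ k * 2 ^ (m - k) := Nat.mul_lt_mul_of_pos_left (hw _) (by positivity)
      _ = 2 ^ m := by rw [← pow_add]; congr 1; omega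
  · have h1 : m - k = (m - (k + 1)) + 1 := by omega
    have h2 : m - 1 - (m - (k + 1)) = k := by omega
    have h3 : 2 ^ m = 2 * (2 ^ k * 2 ^ (m - (k + 1))) := by
      rw [← pow_add, ← pow_succ']; congr 1; omega
    have h4 : w (m - (k + 1)) = if b k then 2 ^ (m - (k + 1)) else 0 := by simp only [w, h2]
    simp only [h1]
    rw [Finset.sum_range_succ, h4]
    split_ifs
    · rw [h3]; ring
    · ring

/-! ### Matchings as sets of marked vertices -/

/-- The marked vertices are those of a matching with `m` edges. -/
def MarksMatching {n : ℕ} (G : SimpleGraph (Fin n)) (mk : ℕ → ℕ) (m : ℕ) : Prop :=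
  (∃ M : G.Subgraph, M.IsMatching ∧ M.edgeSet.ncard = m ∧ ∀ u : Fin n, u ∈ M.verts ↔ mk u ≠ 0) ∧
    ({u ∈ Finset.range n | mk u ≠ 0}).card = 2 * m

theorem marksMatching_zero {n : ℕ} (G : SimpleGraph (Fin n)) :
    MarksMatching G (fun _ => 0) 0 := by
  refine ⟨⟨⊥, ?_, by simp, by simp⟩, by simp⟩
  intro v hv
  simp at hv

theorem MarksMatching.le_matchingNumber {n : ℕ} {G : SimpleGraph (Fin n)} {mk : ℕ → ℕ} {m : ℕ}
    (h : MarksMatching G mk m) : m ≤ G.matchingNumber := by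
  obtain ⟨⟨M, hM, hm, -⟩, -⟩ := h
  -- A supremum in `ℕ` is only meaningful for a bounded set; the number of edges of `G` is a bound.
  refine le_csSup ⟨G.edgeSet.ncard, ?_⟩ ⟨M, hM, hm⟩
  rintro _ ⟨N, -, rfl⟩
  exact Set.ncard_le_ncard N.edgeSet_subset (Set.toFinite _)

theorem MarksMatching.insert {n : ℕ} {G : SimpleGraph (Fin n)} {mk : ℕ → ℕ} {m i j : ℕ}
    (h : MarksMatching G mk m) (hij : G.AdjNat i j) (hi : mk i = 0) (hj : mk j = 0) :
    MarksMatching G (Function.update (Function.update mk i 1) j 1) (m + 1) := by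
  have hne := hij.ne
  obtain ⟨hin, hjn, hadj⟩ := hij
  obtain ⟨⟨M, hM, hm, hv⟩, hc⟩ := h
  refine ⟨⟨M ⊔ G.subgraphOfAdj hadj, ?_, ?_, ?_⟩, ?_⟩
  · refine hM.sup (SimpleGraph.Subgraph.IsMatching.subgraphOfAdj hadj) ?_
    rw [hM.support_eq_verts, (SimpleGraph.Subgraph.IsMatching.subgraphOfAdj hadj).support_eq_verts,
      Set.disjoint_right]
    rintro u hu
    rw [SimpleGraph.subgraphOfAdj_verts, Set.mem_insert_iff, Set.mem_singleton_iff] at hu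
    rw [hv]
    rcases hu with rfl | rfl <;> simp [hi, hj]
  · rw [SimpleGraph.Subgraph.edgeSet_sup, SimpleGraph.edgeSet_subgraphOfAdj, Set.union_singleton,
      Set.ncard_insert_of_notMem _ (Set.toFinite _), hm]
    intro he
    have := M.edge_vert (SimpleGraph.Subgraph.mem_edgeSet.1 he)
    rw [hv] at this
    exact this hi
  · intro u
    rw [SimpleGraph.Subgraph.verts_sup, SimpleGraph.subgraphOfAdj_verts]
    simp only [Set.mem_union, Set.mem_insert_iff, Set.mem_singleton_iff, hv, Function.update_apply,
      Fin.ext_iff]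
    split_ifs <;> simp_all
  · have : {u ∈ Finset.range n | Function.update (Function.update mk i 1) j 1 u ≠ 0} =
        Insert.insert i (Insert.insert j {u ∈ Finset.range n | mk u ≠ 0}) := by
      ext u
      simp only [Finset.mem_filter, Finset.mem_range, Finset.mem_insert, Function.update_apply]
      by_cases h1 : u = i
      · simp [h1, hin]
      · by_cases h2 : u = j
        · simp [h2, hjn]
        · simp [h1, h2]
    rw [this, Finset.card_insert_of_notMem (by simp [hne, hi]),
      Finset.card_insert_of_notMem (by simp [hj]), hc]
    omega

/-! ### Computing a vertex cover by a greedy matching -/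

namespace RAM

open RAM.Program RAM.Expr

/-! Array `3` holds the row offsets `i * n`, array `4` the marks, array `5` the bound on the number
of listed neighbors, arrays `7`, `8`, `9` the listed items, array `6` their number and array `10`
the number of sets of items, array `16` the current table. -/

theorem flat_inj {n u v u' v' : ℕ} (hv : v < n) (hv' : v' < n) (h : u * n + v = u' * n + v') :
    u = u' ∧ v = v' := by
  have h1 : u = u' := by
    rcases lt_trichotomy u u' with hlt | he | hlt
    · have : (u + 1) * n ≤ u' * n := Nat.mul_le_mul_right _ hlt
      rw [Nat.add_mul] at this
      omega
    · exact he
    · have : (u' + 1) * n ≤ u * n := Nat.mul_le_mul_right _ hlt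
      rw [Nat.add_mul] at this
      omega
  subst h1
  exact ⟨rfl, by omega⟩

/-- The program that computes the row offsets. -/
def offsets : Program :=
  .seq (.assign 18 (.plus (.var 0) (.var 0)))
    (.for 11 0 (.seq (.write 3 (.var 11) (.var 22)) (.assign 22 (.plus (.var 22) (.var 0)))))

/-- The machine cannot multiply, so the products `i * n` are accumulated by addition in the scalar
`22`. -/
theorem run_offsets {s : Store} {n : ℕ} (hn : s 0 0 = n) (h₀ : s 22 0 = 0) :
    Run offsets s (n * 40 + 40) fun s' => s' 18 0 = 2 * n ∧ ∀ i < n, s' 3 i = i * n := by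
  refine Run.seq 10 (n * 40 + 30) (by omega) (Run.write (by decide) ?_)
  refine Run.for (N := n) (T := 28)
    (fun k s => s 18 0 = 2 * n ∧ s 22 0 = k * n ∧ ∀ i < k, s 3 i = i * n) ?_ ?_ ?_ ?_ ?_ ?_ ?_ ?_
  · simpa using hn
  · omega
  · decide
  · decide
  · intro k s x h
    simpa using h
  · simp [Expr.val, hn, h₀, two_mul]
  · rintro k s hk hs hf ⟨h1, h2, h3⟩
    have h0 : s 0 0 = n := by rw [hf 0 (by decide)]; simpa using hn
    refine Run.seq 14 14 (by omega) (Run.write (by decide) (Run.write (by decide) ?_))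
    refine ⟨by simpa using h1, by simp [Expr.val, h2, h0]; ring, ?_⟩
    intro i hi
    rcases Nat.lt_succ_iff_lt_or_eq.1 hi with h | rfl
    · simp [Expr.val, hs, h.ne, h3 i h]
    · simp [Expr.val, hs, h2]
  · rintro s - ⟨h1, -, h2⟩
    exact ⟨h1, h2⟩

/-- The entry of the adjacency matrix in row `11` and column `12`. -/
abbrev adjExpr : Expr := .read 1 (.plus (.read 3 (.var 11)) (.var 12))

/-- The memory holds the graph `G` and the row offsets. -/
structure HoldsGraph {n : ℕ} (G : SimpleGraph (Fin n)) (s : Store) : Prop where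
  order : s 0 0 = n
  adj : ∀ i j, i < n → j < n → (s 1 (i * n + j) ≠ 0 ↔ G.AdjNat i j)
  offset : ∀ i < n, s 3 i = i * n

theorem HoldsGraph.congr {n : ℕ} {G : SimpleGraph (Fin n)} {s s' : Store} (h : HoldsGraph G s)
    (h0 : s' 0 = s 0) (h1 : s' 1 = s 1) (h3 : s' 3 = s 3) : HoldsGraph G s' :=
  ⟨by rw [h0, h.order], by rw [h1]; exact h.adj, by rw [h3]; exact h.offset⟩

theorem HoldsGraph.adjExpr_val {n : ℕ} {G : SimpleGraph (Fin n)} {s : Store} (h : HoldsGraph G s)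
    {i j : ℕ} (hi : i < n) (hj : j < n) (hsi : s 11 0 = i) (hsj : s 12 0 = j) :
    adjExpr.val s ≠ 0 ↔ G.AdjNat i j := by
  simp only [Expr.val, hsi, hsj, h.offset i hi]
  exact h.adj i j hi hj

/-- Mark both ends of the edge in row `11` and column `12`, if there is one and neither end is
marked. -/
def matchingBody : Program :=
  .branch adjExpr
    (.branch (.read 4 (.var 11)) .skip
      (.branch (.read 4 (.var 12)) .skip
        (.seq (.write 4 (.var 11) (.const 1))
          (.seq (.write 4 (.var 12) (.const 1)) (.assign 5 (.plus (.var 5) (.const 8)))))))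
    .skip

/-- The program that marks the vertices of a maximal matching. -/
def greedyMatching : Program :=
  .seq (.assign 5 (.const 1)) (.for 11 0 (.for 12 0 matchingBody))

/-- The edges before `(i, j)` have a marked end. -/
def MatchingInv {n : ℕ} (G : SimpleGraph (Fin n)) (i j : ℕ) (s : Store) : Prop :=
  (∃ m, s 5 0 = 8 * m + 1 ∧ MarksMatching G (s 4) m) ∧
    ∀ u v, G.AdjNat u v → u < i ∨ u = i ∧ v < j → s 4 u ≠ 0 ∨ s 4 v ≠ 0

/-- Each new edge adds 8 to the scalar `5`, which therefore holds `8 * m + 1 = 4 * (2 * m) + 1`, one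
more than four times the number of marked vertices. This is the number of listed neighbors that the
exchange argument needs. -/
theorem run_matchingBody {n : ℕ} {G : SimpleGraph (Fin n)} {s : Store} {i j : ℕ}
    (hG : HoldsGraph G s) (hi : i < n) (hj : j < n) (hsi : s 11 0 = i) (hsj : s 12 0 = j)
    (hinv : MatchingInv G i j s) : Run matchingBody s 60 (MatchingInv G i (j + 1)) := by
  have hadj := hG.adjExpr_val hi hj hsi hsj
  obtain ⟨⟨m, h5, hm⟩, hcov⟩ := hinv
  have hstay : (G.AdjNat i j → s 4 i ≠ 0 ∨ s 4 j ≠ 0) → MatchingInv G i (j + 1) s := by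
    intro h
    refine ⟨⟨m, h5, hm⟩, fun u v huv hlt => ?_⟩
    by_cases he : u = i ∧ v = j
    · obtain ⟨rfl, rfl⟩ := he
      exact h huv
    · exact hcov u v huv (by omega)
  refine Run.branch 50 (by decide) (fun h => ?_)
    (fun h => Run.skip (by omega) (hstay fun h' => absurd h (hadj.2 h')))
  have hA := hadj.1 h
  refine Run.branch 40 (by decide)
    (fun h => Run.skip (by omega) (hstay fun _ => Or.inl (by simpa [Expr.val, hsi] using h)))
    fun hi0 => ?_
  refine Run.branch 30 (by decide)
    (fun h => Run.skip (by omega) (hstay fun _ => Or.inr (by simpa [Expr.val, hsj] using h)))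
    fun hj0 => ?_
  refine Run.seq 8 20 (by omega) (Run.write (by decide) ?_)
  refine Run.seq 8 10 (by omega) (Run.write (by decide) (Run.write (by decide) ?_))
  simp only [Expr.val, hsi] at hi0
  simp only [Expr.val, hsj] at hj0
  have hM := hm.insert hA hi0 hj0
  refine ⟨⟨m + 1, ?_, ?_⟩, fun u v huv hlt => ?_⟩
  · simp [Expr.val, h5]; ring
  · simpa [Expr.val, hsi, hsj] using hM
  · have hu : ∀ w, Function.update (Function.update (s 4) i 1) j 1 w ≠ 0 ↔
        w = i ∨ w = j ∨ s 4 w ≠ 0 := by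
      intro w
      simp only [Function.update_apply]
      split_ifs <;> simp_all
    have h4 : s 4 u ≠ 0 ∨ s 4 v ≠ 0 ∨ u = i := by
      by_cases he : u = i ∧ v = j
      · exact Or.inr (Or.inr he.1)
      · have := hcov u v huv (by omega)
        tauto
    have := (hu u).2
    have := (hu v).2
    simp only [Expr.val, hsi]
    simp [hsj]
    tauto

theorem run_greedyMatching {n : ℕ} {G : SimpleGraph (Fin n)} {s : Store}
    (hG : HoldsGraph G s) (h4 : s 4 = fun _ => 0) :
    Run greedyMatching s (n * (n * 72 + 21) + 20) fun s' =>
      (∃ m, s' 5 0 = 8 * m + 1 ∧ MarksMatching G (s' 4) m) ∧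
        ∀ u v, G.AdjNat u v → s' 4 u ≠ 0 ∨ s' 4 v ≠ 0 := by
  refine Run.seq 10 (n * (n * 72 + 21) + 10) (by omega) (Run.write (by decide) ?_)
  have hG₁ := hG.congr (s' := Function.update s 5 (Function.update (s 5) ((const 0).val s)
    ((const 1).val s))) (by simp) (by simp) (by simp)
  refine Run.for (N := n) (T := n * 72 + 9) (fun i => MatchingInv G i 0) hG₁.order
    (by ring_nf; omega) (by decide) (by decide) ?_ ?_ ?_ ?_
  · intro k s x h
    simpa [MatchingInv] using h
  · refine ⟨⟨0, by simp [Expr.val], ?_⟩, by omega⟩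
    simpa [h4] using marksMatching_zero G
  · intro i s₁ hi hsi hf hinv
    have hG₂ := hG₁.congr (hf 0 (by decide)) (hf 1 (by decide)) (hf 3 (by decide))
    refine Run.for (N := n) (T := 60) (MatchingInv G i) hG₂.order (by omega) (by decide)
      (by decide) ?_ hinv ?_ ?_
    · intro k s x h
      simpa [MatchingInv] using h
    · intro j s₂ hj hsj hf' hinv
      exact run_matchingBody (hG₂.congr (hf' 0 (by decide)) (hf' 1 (by decide)) (hf' 3 (by decide)))
        hi hj (by rw [hf' 11 (by decide), hsi]) hsj hinv
    · rintro s - ⟨h1, h2⟩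
      refine ⟨h1, fun u v huv hlt => h2 u v huv ?_⟩
      obtain ⟨_, hv, _⟩ := huv
      omega
  · rintro s - ⟨h1, h2⟩
    refine ⟨h1, fun u v huv => h2 u v huv ?_⟩
    obtain ⟨hu, _, _⟩ := huv
    omega

/-! ### Listing boundedly many edges at the cover -/

/-- The edge `uv` with the color `c` is one of the items. -/
def Listed (s : Store) (u v c : ℕ) : Prop :=
  ∃ e < s 6 0, s 7 e = u ∧ s 8 e = v ∧ s 9 e = c

theorem Listed.congr {s s' : Store} (h6 : s' 6 = s 6) (h7 : s' 7 = s 7) (h8 : s' 8 = s 8)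
    (h9 : s' 9 = s 9) : Listed s' = Listed s := by
  unfold Listed
  rw [h6, h7, h8, h9]

/-- The program that adds an item to the list. -/
def push (c : ℕ) : Program :=
  .seq (.write 7 (.var 6) (.var 11)) (.seq (.write 8 (.var 6) (.var 12))
    (.seq (.write 9 (.var 6) (.const c)) (.seq (.assign 6 (.plus (.var 6) (.const 1)))
      (.assign 10 (.plus (.var 10) (.var 10))))))

/-- Doubling the scalar `10` with every item keeps it equal to the number of sets of items, without
exponentiation. -/
theorem run_push (s : Store) (c : ℕ) :
    Run (push c) s 40 fun s' => s' 6 0 = s 6 0 + 1 ∧ s' 10 0 = 2 * s 10 0 ∧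
      ∀ u v d, Listed s' u v d ↔ Listed s u v d ∨ (u = s 11 0 ∧ v = s 12 0 ∧ d = c) := by
  refine Run.seq 8 32 (by omega) (Run.write (by decide) ?_)
  refine Run.seq 8 24 (by omega) (Run.write (by decide) ?_)
  refine Run.seq 8 16 (by omega) (Run.write (by simp [Expr.cost]) ?_)
  refine Run.seq 8 8 (by omega) (Run.write (by decide) (Run.write (by decide) ?_))
  refine ⟨by simp [Expr.val], by simp [Expr.val, two_mul], fun u v d => ?_⟩
  simp [Listed, Expr.val, Function.update_apply]
  constructor
  · rintro ⟨e, he, h1, h2, h3⟩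
    by_cases h : e = s 6 0
    · simp only [h, if_true] at h1 h2 h3
      exact Or.inr ⟨h1.symm, h2.symm, h3.symm⟩
    · simp only [h, if_false] at h1 h2 h3
      exact Or.inl ⟨e, by omega, h1, h2, h3⟩
  · rintro (⟨e, he, h1, h2, h3⟩ | ⟨h1, h2, h3⟩)
    · exact ⟨e, by omega, by simp [he.ne, h1], by simp [he.ne, h2], by simp [he.ne, h3]⟩
    · exact ⟨s 6 0, by omega, by simp [h1], by simp [h2], by simp [h3]⟩

/-- List the edge in row `11` and column `12`, with both colors. -/
def listBody : Program :=
  .branch adjExpr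
    (.branch (.minus (.var 5) (.var 13))
      (.seq (push 0) (.seq (push 1) (.assign 13 (.plus (.var 13) (.const 1)))))
      .skip)
    .skip

/-- List some edges at every marked vertex. -/
def listEdges : Program :=
  .seq (.assign 10 (.const 1)) (.for 11 0
    (.branch (.read 4 (.var 11)) (.seq (.assign 13 (.const 0)) (.for 12 0 listBody)) .skip))

/-- The neighbors `y < j` of `x` are listed, or at least `K` ones are. -/
def RowListed {n : ℕ} (G : SimpleGraph (Fin n)) (K x j d : ℕ) (s : Store) : Prop :=
  ∃ S : Finset ℕ, S.card = d ∧ (∀ y ∈ S, y < j ∧ ∀ c < 2, Listed s x y c) ∧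
    ∀ y < j, G.AdjNat x y → y ∈ S ∨ K ≤ d

theorem RowListed.mono {n : ℕ} {G : SimpleGraph (Fin n)} {K x j d : ℕ} {s s' : Store}
    (h : RowListed G K x j d s) (hs : ∀ u v c, Listed s u v c → Listed s' u v c) :
    RowListed G K x j d s' := by
  obtain ⟨S, h1, h2, h3⟩ := h
  exact ⟨S, h1, fun y hy => ⟨(h2 y hy).1, fun c hc => hs _ _ _ ((h2 y hy).2 c hc)⟩, h3⟩

/-- The state of the list when the rows below `i` are done, and `D` items may have been added
since then. -/
def ListInv {n : ℕ} (G : SimpleGraph (Fin n)) (K : ℕ) (mk : ℕ → ℕ) (i D : ℕ) (s : Store) : Prop :=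
  s 10 0 = 2 ^ s 6 0 ∧ (∀ u v c, Listed s u v c → G.AdjNat u v ∧ c < 2) ∧
    s 6 0 ≤ 2 * K * ({u ∈ Finset.range i | mk u ≠ 0}).card + D ∧
    ∀ x < i, mk x ≠ 0 → ∃ d, RowListed G K x n d s

/-- A neighbor is passed over only when the quota `K` is exhausted, which is the alternative `K ≤ d`
in `RowListed`. A neighbor that is taken costs two items, one for each color; hence the slack `2 *
d`. -/
theorem run_listBody {n : ℕ} {G : SimpleGraph (Fin n)} {s : Store} {K i j d : ℕ} {mk : ℕ → ℕ}
    (hG : HoldsGraph G s) (hi : i < n) (hj : j < n) (hsi : s 11 0 = i) (hsj : s 12 0 = j)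
    (hK : s 5 0 = K) (hd : s 13 0 = d) (hdK : d ≤ K) (hinv : ListInv G K mk i (2 * d) s)
    (hrow : RowListed G K i j d s) :
    Run listBody s 130 fun s' => ∃ d, s' 13 0 = d ∧ d ≤ K ∧ ListInv G K mk i (2 * d) s' ∧
      RowListed G K i (j + 1) d s' := by
  have hadj := hG.adjExpr_val hi hj hsi hsj
  obtain ⟨S, hS, hS1, hS2⟩ := hrow
  have hstay : (G.AdjNat i j → K ≤ d) → ∃ d, s 13 0 = d ∧ d ≤ K ∧ ListInv G K mk i (2 * d) s ∧
      RowListed G K i (j + 1) d s := by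
    intro h
    refine ⟨d, hd, hdK, hinv, S, hS, fun y hy => ⟨by have := (hS1 y hy).1; omega, (hS1 y hy).2⟩, ?_⟩
    intro y hy hA
    rcases Nat.lt_succ_iff_lt_or_eq.1 hy with h' | rfl
    · exact hS2 y h' hA
    · exact Or.inr (h hA)
  refine Run.branch 120 (by decide) (fun h => ?_)
    (fun h => Run.skip (by omega) (hstay fun h' => absurd h (hadj.2 h')))
  have hA := hadj.1 h
  refine Run.branch 110 (by decide) (fun h => ?_)
    (fun h => Run.skip (by omega) (hstay fun h' => ?_))
  swap
  · simp only [Expr.val, hK, hd] at h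
    omega
  simp only [Expr.val, hK, hd] at h
  refine Run.seq 40 70 (by omega) ((run_push s 0).monoFrame le_rfl ?_)
  rintro s₁ hf₁ ⟨a1, a2, a3⟩
  refine Run.seq 40 30 (by omega) ((run_push s₁ 1).monoFrame le_rfl ?_)
  rintro s₂ hf₂ ⟨b1, b2, b3⟩
  refine Run.write (by decide) ?_
  have hf : ∀ a, a ∉ (push 0).writes → s₂ a = s a := fun a ha => by rw [hf₂ a ha, hf₁ a ha]
  set s₃ := Function.update s₂ 13 (Function.update (s₂ 13) ((const 0).val s₂)
    (((var 13).plus (const 1)).val s₂)) with hs₃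
  have hL : ∀ u v c, Listed s₃ u v c ↔
      Listed s u v c ∨ (u = i ∧ v = j ∧ c = 0) ∨ (u = i ∧ v = j ∧ c = 1) := by
    intro u v c
    rw [Listed.congr (s := s₂) (by simp [s₃]) (by simp [s₃]) (by simp [s₃]) (by simp [s₃]),
      b3, a3, hf₁ 11 (by decide), hf₁ 12 (by decide), hsi, hsj, or_assoc]
  have h6 : s₃ 6 0 = s 6 0 + 2 := by simp [s₃, b1, a1]
  have h10 : s₃ 10 0 = 4 * s 10 0 := by simp [s₃, b2, a2]; ring
  obtain ⟨i1, i2, i3, i4⟩ := hinv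
  refine ⟨d + 1, ?_, by omega, ⟨?_, ?_, by rw [h6]; omega, ?_⟩, insert j S, ?_, ?_, ?_⟩
  · simp [s₃, Expr.val, hf 13 (by decide), hd]
  · rw [h6, h10, i1]; ring
  · intro u v c h
    rw [hL] at h
    rcases h with h | ⟨rfl, rfl, rfl⟩ | ⟨rfl, rfl, rfl⟩
    · exact i2 u v c h
    · exact ⟨hA, by omega⟩
    · exact ⟨hA, by omega⟩
  · intro x hx hm
    obtain ⟨d, hd⟩ := i4 x hx hm
    exact ⟨d, hd.mono fun u v c h => (hL u v c).2 (Or.inl h)⟩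
  · rw [Finset.card_insert_of_notMem (fun h => by have := (hS1 j h).1; omega), hS]
  · intro y hy
    rcases Finset.mem_insert.1 hy with rfl | hy
    · exact ⟨by omega, fun c hc => (hL _ _ _).2 (by omega)⟩
    · exact ⟨by have := (hS1 y hy).1; omega, fun c hc => (hL _ _ _).2 (Or.inl ((hS1 y hy).2 c hc))⟩
  · intro y hy hA
    rw [Finset.mem_insert]
    rcases Nat.lt_succ_iff_lt_or_eq.1 hy with h' | rfl
    · rcases hS2 y h' hA with h | h
      · exact Or.inl (Or.inr h)
      · exact Or.inr (by omega)
    · exact Or.inl (Or.inl rfl)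

theorem run_listEdges {n : ℕ} {G : SimpleGraph (Fin n)} {s : Store} {K : ℕ}
    (hG : HoldsGraph G s) (hK : s 5 0 = K) (h6 : s 6 0 = 0) :
    Run listEdges s (n * (n * 142 + 40) + 20) (ListInv G K (s 4) n 0) := by
  refine Run.seq 10 (n * (n * 142 + 40) + 10) (by omega) (Run.write (by decide) ?_)
  set s₀ := Function.update s 10 (Function.update (s 10) ((const 0).val s) ((const 1).val s))
  have hG₁ : HoldsGraph G s₀ := hG.congr (by simp [s₀]) (by simp [s₀]) (by simp [s₀])
  have h4 : s₀ 4 = s 4 := by simp [s₀]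
  have h5 : s₀ 5 0 = K := by simpa [s₀] using hK
  refine Run.for (N := n) (T := n * 142 + 28) (fun i => ListInv G K (s 4) i 0) hG₁.order
    (by ring_nf; omega) (by decide) (by decide) ?_ ?_ ?_ ?_
  · intro k s x h
    simpa [ListInv, RowListed, Listed] using h
  · refine ⟨by simp [s₀, Expr.val, h6], ?_, by simp [s₀, h6], by omega⟩
    rintro u v c ⟨e, he, -⟩
    simp [s₀, h6] at he
  · intro i s₁ hi hsi hf hinv
    have hG₂ := hG₁.congr (hf 0 (by decide)) (hf 1 (by decide)) (hf 3 (by decide))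
    have h4' : s₁ 4 = s 4 := by rw [hf 4 (by decide), h4]
    have h5' : s₁ 5 0 = K := by rw [hf 5 (by decide), h5]
    obtain ⟨i1, i2, i3, i4⟩ := hinv
    refine Run.branch (n * 142 + 20) (by simp only [Expr.cost]; omega) (fun h => ?_)
      (fun h => Run.skip (by omega) ⟨i1, i2, ?_, ?_⟩)
    · simp only [Expr.val, hsi, h4'] at h
      refine Run.seq 5 (n * 142 + 9) (by omega) (Run.write (by decide) ?_)
      set s₂ := Function.update s₁ 13
        (Function.update (s₁ 13) ((const 0).val s₁) ((const 0).val s₁))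
      have hL : Listed s₂ = Listed s₁ :=
        Listed.congr (by simp [s₂]) (by simp [s₂]) (by simp [s₂]) (by simp [s₂])
      have hG₃ : HoldsGraph G s₂ := hG₂.congr (by simp [s₂]) (by simp [s₂]) (by simp [s₂])
      refine Run.for (N := n) (T := 130)
        (fun j s' => ∃ d, s' 13 0 = d ∧ d ≤ K ∧ ListInv G K (s 4) i (2 * d) s' ∧
          RowListed G K i j d s') hG₃.order (by omega) (by decide) (by decide) ?_ ?_ ?_ ?_
      · intro k s x h
        simpa [ListInv, RowListed, Listed] using h
      · refine ⟨0, by simp [s₂, Expr.val], by omega, ⟨?_, ?_, ?_, ?_⟩, ∅, rfl, by simp, by simp⟩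
        · simpa [s₂] using i1
        · rw [hL]; exact i2
        · simpa [s₂] using i3
        · simp only [RowListed, hL]; exact i4
      · rintro j s₃ hj hsj hf' ⟨d, hd, hdK, hinv, hrow⟩
        refine run_listBody (hG₃.congr (hf' 0 (by decide)) (hf' 1 (by decide)) (hf' 3 (by decide)))
          hi hj ?_ hsj ?_ hd hdK hinv hrow
        · rw [hf' 11 (by decide)]; simpa [s₂] using hsi
        · rw [hf' 5 (by decide)]; simpa [s₂] using h5'
      · rintro s₃ - ⟨d, -, hdK, ⟨j1, j2, j3, j4⟩, hrow⟩
        refine ⟨j1, j2, ?_, ?_⟩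
        -- The slack `2 * d ≤ 2 * K` of the finished row is charged to the marked vertex `i`.
        · rw [Finset.range_add_one, Finset.filter_insert, if_pos h,
            Finset.card_insert_of_notMem (by simp), Nat.mul_add]
          omega
        · intro x hx hm
          rcases Nat.lt_succ_iff_lt_or_eq.1 hx with h' | rfl
          · exact j4 x h' hm
          · exact ⟨d, hrow⟩
    · simp only [Expr.val, hsi, h4'] at h
      rw [Finset.range_add_one, Finset.filter_insert, if_neg (by simp [h])]
      exact i3
    · simp only [Expr.val, hsi, h4'] at h
      intro x hx hm
      rcases Nat.lt_succ_iff_lt_or_eq.1 hx with h' | rfl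
      · exact i4 x h' hm
      · exact absurd h hm
  · exact fun s _ h => h

end RAM

/-! ### Adding edges to a table -/

/-- Add the edge `uv` with the color `c` to a table. -/
def addEdge (p : ℕ → ℕ) (u v c : ℕ) : ℕ → ℕ :=
  Function.update (Function.update p (2 * u + c) (v + 1)) (2 * v + c) (u + 1)

section AddEdge

variable {A : ℕ → ℕ → Prop} {p : ℕ → ℕ} {u v c : ℕ}

theorem IsTable.addEdge (hA : ∀ u v, A u v → A v u) (hne : ∀ u v, A u v → u ≠ v)
    (hp : IsTable A p) (hc : c < 2) (huv : A u v) (hu : p (2 * u + c) = 0)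
    (hv : p (2 * v + c) = 0) (huv' : p (2 * u + (1 - c)) ≠ v + 1) :
    IsTable A (addEdge p u v c) := by
  have hne' := hne u v huv
  have hc1 : 1 - c < 2 := by omega
  have hvu' : p (2 * v + (1 - c)) ≠ u + 1 := fun h => huv' (hp _ _ _ hc1 h).2.1
  intro a d b hd h
  have hdd : d = c ∨ d = 1 - c := by omega
  have e1 : ∀ a b : ℕ, 2 * a + c = 2 * b + c ↔ a = b := by omega
  have e3 : ∀ a b : ℕ, 2 * a + (1 - c) ≠ 2 * b + c := by omega
  have hcc : 1 - (1 - c) = c := by omega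
  rcases hdd with rfl | rfl
  · simp only [_root_.addEdge, Function.update_apply, e1, e3, if_false] at h ⊢
    split_ifs at h with h1 h2
    · obtain rfl : u = b := by omega
      subst h1
      exact ⟨hA _ _ huv, by simp [hne'], hvu'⟩
    · obtain rfl : v = b := by omega
      subst h2
      exact ⟨huv, by simp, huv'⟩
    · obtain ⟨a1, a2, a3⟩ := hp a d b hd h
      have hbu : b ≠ u := by rintro rfl; omega
      have hbv : b ≠ v := by rintro rfl; omega
      simp only [hbu, hbv, if_false]
      exact ⟨a1, a2, a3⟩
  · simp only [_root_.addEdge, Function.update_apply, e1, e3, if_false, hcc] at h ⊢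
    obtain ⟨a1, a2, a3⟩ := hp a (1 - c) b hd h
    rw [hcc] at a3
    refine ⟨a1, a2, ?_⟩
    split_ifs with h1 h2
    · subst h1
      intro h'
      obtain rfl : u = b := by omega
      exact hvu' h
    · subst h2
      intro h'
      obtain rfl : v = b := by omega
      exact huv' h
    · exact a3

theorem card_usedCells_addEdge {n : ℕ} (hun : u < n) (hvn : v < n) (huv : u ≠ v) (hc : c < 2)
    (hu : p (2 * u + c) = 0) (hv : p (2 * v + c) = 0) :
    (usedCells n (addEdge p u v c)).card = (usedCells n p).card + 2 := by
  have : usedCells n (addEdge p u v c) =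
      insert (2 * u + c) (insert (2 * v + c) (usedCells n p)) := by
    ext k
    simp only [mem_usedCells, Finset.mem_insert, addEdge, Function.update_apply]
    by_cases h1 : k = 2 * v + c
    · rw [if_pos h1]; omega
    · by_cases h2 : k = 2 * u + c
      · rw [if_neg h1, if_pos h2]; omega
      · simp [h1, h2]
  rw [this, Finset.card_insert_of_notMem, Finset.card_insert_of_notMem]
  · simp [mem_usedCells, hv]
  · simp only [Finset.mem_insert, mem_usedCells, hu]
    omega

/-- The table `p` with the edge `uv` of color `c` added, if this is possible. -/
def tryEdge (p : ℕ → ℕ) (u v c : ℕ) : ℕ → ℕ :=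
  if p (2 * u + c) = 0 ∧ p (2 * v + c) = 0 ∧ p (2 * u + (1 - c)) ≠ v + 1 then addEdge p u v c else p

theorem IsTable.tryEdge (hA : ∀ u v, A u v → A v u) (hne : ∀ u v, A u v → u ≠ v)
    (hp : IsTable A p) (hc : c < 2) (huv : A u v) : IsTable A (tryEdge p u v c) := by
  unfold _root_.tryEdge
  split_ifs with h
  · exact hp.addEdge hA hne hc huv h.1 h.2.1 h.2.2
  · exact hp

theorem tryEdge_of_ne_zero {k : ℕ} (h : p k ≠ 0) : tryEdge p u v c k = p k := by
  unfold tryEdge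
  split_ifs with h'
  · rw [addEdge, Function.update_of_ne, Function.update_of_ne]
    · rintro rfl; exact h h'.1
    · rintro rfl; exact h h'.2.1
  · rfl

/-- Adding the edges of a table `q` one by one never fails. -/
theorem tryEdge_subtable {q : ℕ → ℕ} (hne : ∀ u v, A u v → u ≠ v) (hp : IsTable A p) (hq : IsTable A q)
    (hc : c < 2) (hpq : ∀ k, p k = 0 ∨ p k = q k) (huv : q (2 * u + c) = v + 1) :
    tryEdge p u v c (2 * u + c) = v + 1 ∧ ∀ k, tryEdge p u v c k = 0 ∨ tryEdge p u v c k = q k := by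
  obtain ⟨q1, q2, q3⟩ := hq u c v hc huv
  by_cases h0 : p (2 * u + c) = 0
  -- If the cell at `v` were filled, it would agree with `q` and name `u`; by symmetry of `p` the
  -- cell at `u` would be filled too.
  · have h1 : p (2 * v + c) = 0 := by
      by_contra h
      have h' := (hpq (2 * v + c)).resolve_left h
      rw [q2] at h'
      have := (hp v c u hc h').2.1
      omega
    have h2 : p (2 * u + (1 - c)) ≠ v + 1 := by
      intro h
      rcases hpq (2 * u + (1 - c)) with h' | h'
      · omega
      · exact q3 (h'.symm.trans h)
    rw [tryEdge, if_pos ⟨h0, h1, h2⟩, addEdge]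
    have hne' : 2 * u + c ≠ 2 * v + c := by
      have := hne u v q1
      omega
    refine ⟨by rw [Function.update_of_ne hne', Function.update_self], fun k => ?_⟩
    simp only [Function.update_apply]
    split_ifs with e1 e2
    · exact Or.inr (by rw [e1, q2])
    · exact Or.inr (by rw [e2, huv])
    · exact hpq k
  · have h1 := (hpq (2 * u + c)).resolve_left h0
    rw [tryEdge, if_neg (fun h => h0 h.1)]
    exact ⟨h1.trans huv, hpq⟩

end AddEdge

/-- Hence emptying the first `2 * n` cells empties the whole table. -/
theorem IsTable.eq_zero {n : ℕ} {G : SimpleGraph (Fin n)} {p : ℕ → ℕ} (hp : IsTable G.AdjNat p)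
    {k : ℕ} (hk : 2 * n ≤ k) : p k = 0 := by
  by_contra h
  obtain ⟨v, hv⟩ := Nat.exists_eq_succ_of_ne_zero h
  obtain ⟨hu, -⟩ := (hp.at hv).1
  omega

/-! ### Placing an item, writing the output, clearing the table -/

namespace RAM

open RAM.Program RAM.Expr

/-- The cell of color `c` at the end `u` of an item, when `u` and `c` are given by expressions. -/
abbrev cellExpr (u c : Expr) : Expr := .plus (.plus u u) c

/-- The first end, the second end and the color of item `20`. -/
abbrev itemFst : Expr := .read 7 (.var 20)
abbrev itemSnd : Expr := .read 8 (.var 20)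
abbrev itemColor : Expr := .read 9 (.var 20)

/-- An expression that is nonzero if `x` and `y` differ. -/
abbrev neExpr (x y : Expr) : Expr := .plus (.minus x y) (.minus y x)

/-- Add the current item to the table if possible. -/
def placeItem : Program :=
  .branch (.read 16 (cellExpr itemFst itemColor)) .skip
    (.branch (.read 16 (cellExpr itemSnd itemColor)) .skip
      (.branch (neExpr (.read 16 (cellExpr itemFst (.minus (.const 1) itemColor)))
          (.plus itemSnd (.const 1)))
        (.seq (.write 16 (cellExpr itemFst itemColor) (.plus itemSnd (.const 1)))
          (.seq (.write 16 (cellExpr itemSnd itemColor) (.plus itemFst (.const 1)))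
            (.assign 15 (.plus (.var 15) (.const 2)))))
        .skip))

theorem run_placeItem {n : ℕ} {s : Store} {e u v c : ℕ} (he : s 20 0 = e) (hu : s 7 e = u)
    (hv : s 8 e = v) (hc : s 9 e = c) (hc2 : c < 2) (hun : u < n) (hvn : v < n) (huv : u ≠ v)
    (hcnt : s 15 0 = (usedCells n (s 16)).card) :
    Run placeItem s 150 fun s' => s' 16 = tryEdge (s 16) u v c ∧
      s' 15 0 = (usedCells n (s' 16)).card := by
  refine Run.branch 135 (by decide) (fun h => Run.skip (by omega) ?_) (fun h1 => ?_)
  · simp only [Expr.val, he, hu, hc, ← two_mul] at h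
    exact ⟨by rw [tryEdge, if_neg (fun h' => h h'.1)], hcnt⟩
  simp only [Expr.val, he, hu, hc, ← two_mul] at h1
  refine Run.branch 122 (by decide) (fun h => Run.skip (by omega) ?_) (fun h2 => ?_)
  · simp only [Expr.val, he, hv, hc, ← two_mul] at h
    exact ⟨by rw [tryEdge, if_neg (fun h' => h h'.2.1)], hcnt⟩
  simp only [Expr.val, he, hv, hc, ← two_mul] at h2
  refine Run.branch 80 (by decide) (fun h3 => ?_) (fun h => Run.skip (by omega) ?_)
  swap
  · simp only [Expr.val, he, hu, hv, hc, ← two_mul] at h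
    exact ⟨by rw [tryEdge, if_neg (fun h' => h'.2.2 (by omega))], hcnt⟩
  simp only [Expr.val, he, hu, hv, hc, ← two_mul] at h3
  have hT : tryEdge (s 16) u v c = addEdge (s 16) u v c := by
    rw [tryEdge, if_pos ⟨h1, h2, by omega⟩]
  refine Run.seq 30 50 (by omega) (Run.write (by decide) ?_)
  refine Run.seq 30 20 (by omega) (Run.write (by decide) (Run.write (by decide) ?_))
  have : ∀ s' : Store, s' 16 = addEdge (s 16) u v c → s' 15 0 = s 15 0 + 2 →
      s' 16 = tryEdge (s 16) u v c ∧ s' 15 0 = (usedCells n (s' 16)).card := by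
    intro s' a1 a2
    refine ⟨a1.trans hT.symm, ?_⟩
    rw [a1, a2, hcnt, card_usedCells_addEdge hun hvn huv hc2 h1 h2]
  refine this _ ?_ ?_
  · simp [Expr.val, he, hu, hv, hc, ← two_mul, addEdge]
  · simp [Expr.val]

/-- Write the entry in row `11` and column `12` of the matrix described by the current table. -/
def outputBody : Program :=
  .branch (neExpr (.read 16 (.plus (.var 11) (.var 11))) (.plus (.var 12) (.const 1)))
    (.branch (neExpr (.read 16 (.plus (.plus (.var 11) (.var 11)) (.const 1)))
        (.plus (.var 12) (.const 1)))
      (.write 2 (.plus (.read 3 (.var 11)) (.var 12)) (.const 0))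
      (.write 2 (.plus (.read 3 (.var 11)) (.var 12)) (.const 2)))
    (.write 2 (.plus (.read 3 (.var 11)) (.var 12)) (.const 1))

/-- Write the matrix described by the current table. -/
def output : Program := .for 11 0 (.for 12 0 outputBody)

theorem run_outputBody {n i j : ℕ} {s : Store} (hoff : s 3 i = i * n) (hsi : s 11 0 = i)
    (hsj : s 12 0 = j) :
    Run outputBody s 80 fun s' =>
      s' 2 = Function.update (s 2) (i * n + j) (tableEntry (s 16) i j) := by
  refine Run.branch 50 (by decide) (fun h1 => ?_) (fun h1 => ?_)
  · simp only [Expr.val, hsi, hsj, ← two_mul] at h1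
    refine Run.branch 20 (by decide) (fun h2 => ?_) (fun h2 => ?_)
    · simp only [Expr.val, hsi, hsj, ← two_mul] at h2
      refine Run.write (by decide) ?_
      rw [tableEntry, if_neg (by omega), if_neg (by omega)]
      simp [Expr.val, hsi, hsj, hoff]
    · simp only [Expr.val, hsi, hsj, ← two_mul] at h2
      refine Run.write (by decide) ?_
      rw [tableEntry, if_neg (by omega), if_pos (by omega)]
      simp [Expr.val, hsi, hsj, hoff]
  · simp only [Expr.val, hsi, hsj, ← two_mul] at h1
    refine Run.write (by decide) ?_
    rw [tableEntry, if_pos (by omega)]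
    simp [Expr.val, hsi, hsj, hoff]

theorem run_output {n : ℕ} {s : Store} (hn : s 0 0 = n) (hoff : ∀ i < n, s 3 i = i * n) :
    Run output s (n * (n * 92 + 21) + 9) fun s' =>
      ∀ u v, u < n → v < n → s' 2 (u * n + v) = tableEntry (s 16) u v := by
  refine Run.for (N := n) (T := n * 92 + 9)
    (fun i s' => ∀ u v, u < i → u < n → v < n → s' 2 (u * n + v) = tableEntry (s 16) u v) hn
    (by ring_nf; omega) (by decide) (by decide) ?_ (by omega) ?_
    (fun s' _ h u v hu hv => h u v hu hu hv)
  · intro k s' x h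
    simpa using h
  · intro i s₁ hi hsi hf hinv
    refine Run.for (N := n) (T := 80)
      (fun j s' => ∀ u v, u < i ∨ u = i ∧ v < j → u < n → v < n →
        s' 2 (u * n + v) = tableEntry (s 16) u v) (by rw [hf 0 (by decide), hn])
      (by omega) (by decide) (by decide) ?_ ?_ ?_ ?_
    · intro k s' x h
      simpa using h
    · intro u v h
      exact hinv u v (by omega)
    · intro j s₂ hj hsj hf' hinv'
      refine (run_outputBody (n := n) (i := i) (j := j)
        (by rw [hf' 3 (by decide), hf 3 (by decide), hoff i hi])
        (by rw [hf' 11 (by decide), hsi]) hsj).mono le_rfl ?_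
      intro s₃ h3 u v huv hu hv
      rw [h3, Function.update_apply, hf' 16 (by decide), hf 16 (by decide)]
      by_cases he : u = i ∧ v = j
      · rw [he.1, he.2, if_pos rfl]
      · rw [if_neg (fun h => he (flat_inj hv hj h))]
        exact hinv' u v (by omega) hu hv
    · intro s₂ _ h u v hu hun hv
      exact h u v (by omega) hun hv

/-- Empty the table. -/
def clearTable : Program := .for 20 18 (.write 16 (.var 20) (.const 0))

theorem run_clearTable {n : ℕ} {s : Store} (hn : s 18 0 = 2 * n)
    (h16 : ∀ k, 2 * n ≤ k → s 16 k = 0) :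
    Run clearTable s (2 * n * 17 + 9) fun s' => s' 16 = fun _ => 0 := by
  refine Run.for (N := 2 * n) (T := 5)
    (fun i s' => ∀ k, k < i ∨ 2 * n ≤ k → s' 16 k = 0) hn (by omega) (by decide) (by decide) ?_ ?_
    ?_ ?_
  · intro k s' x h
    simpa using h
  · intro k hk
    exact h16 k (by omega)
  · intro i s₁ hi hsi hf hinv
    refine Run.write (by decide) ?_
    intro k hk
    simp only [Expr.val, hsi, Function.update_self, Function.update_apply]
    split_ifs with h
    · rfl
    · exact hinv k (by omega)
  · intro s' _ h
    funext k
    exact h k (by omega)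

/-! ### Search through all sets of items -/

/-- Take in the current item if the leading bit of the word `17` is set. -/
def itemBody : Program :=
  .seq (.assign 17 (.plus (.var 17) (.var 17)))
    (.branch (.minus (.plus (.var 17) (.const 1)) (.var 10))
      (.seq (.assign 17 (.minus (.var 17) (.var 10))) placeItem)
      .skip)

/-- The list of items, as kept by the program, represents edges of the graph `G`. -/
structure HoldsItems {n : ℕ} (G : SimpleGraph (Fin n)) (m : ℕ) (s : Store) : Prop where
  count : s 6 0 = m
  words : s 10 0 = 2 ^ m
  adj : ∀ e < m, G.AdjNat (s 7 e) (s 8 e) ∧ s 9 e < 2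

theorem HoldsItems.congr {n m : ℕ} {G : SimpleGraph (Fin n)} {s s' : Store} (h : HoldsItems G m s)
    (h6 : s' 6 = s 6) (h7 : s' 7 = s 7) (h8 : s' 8 = s 8) (h9 : s' 9 = s 9)
    (h10 : s' 10 = s 10) : HoldsItems G m s' :=
  ⟨by rw [h6, h.count], by rw [h10, h.words], by rw [h7, h8, h9]; exact h.adj⟩

/-- The word `g e` prescribes to take in, from item `e` on, the items that belong to the
table `q`. -/
structure Prescribes (q : ℕ → ℕ) (m : ℕ) (fst snd color g : ℕ → ℕ) : Prop where
  lt : ∀ e ≤ m, g e < 2 ^ m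
  take : ∀ e < m, q (2 * fst e + color e) = snd e + 1 → 2 * g e = 2 ^ m + g (e + 1)
  leave : ∀ e < m, q (2 * fst e + color e) ≠ snd e + 1 → 2 * g e = g (e + 1)

theorem exists_prescribes (q : ℕ → ℕ) (m : ℕ) (fst snd color : ℕ → ℕ) :
    ∃ g, Prescribes q m fst snd color g := by
  obtain ⟨g, h1, h2⟩ := exists_bits (fun e => q (2 * fst e + color e) = snd e + 1) m
  exact ⟨g, h1, fun e he h => by rw [h2 e he, if_pos h], fun e he h => by
    rw [h2 e he, if_neg h, zero_add]⟩

/-- The state after `e` items, where `t` tells whether the table `q` is aimed at. -/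
def ItemInv {n : ℕ} (G : SimpleGraph (Fin n)) (q : ℕ → ℕ) (fst snd color g : ℕ → ℕ) (t : Prop)
    (e : ℕ) (s : Store) : Prop :=
  IsTable G.AdjNat (s 16) ∧ s 15 0 = (usedCells n (s 16)).card ∧
    (t → s 17 0 = g e ∧ (∀ k, s 16 k = 0 ∨ s 16 k = q k) ∧
      ∀ i < e, q (2 * fst i + color i) = snd i + 1 → s 16 (2 * fst i + color i) = snd i + 1)

/-- The test `2w + 1 - 2 ^ m ≠ 0` says that doubling the word `w` brings out a carry. For the word
that aims at `q`, `Prescribes` turns this into membership of the item in `q`, as the remaining word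
is below `2 ^ m`. For all other words only the legality of the table and the count of its cells are
maintained. -/
theorem run_itemBody {n m e : ℕ} {G : SimpleGraph (Fin n)} {q g : ℕ → ℕ} {t : Prop} {s : Store}
    (hq : IsTable G.AdjNat q) (hs : HoldsItems G m s) (he : e < m) (hse : s 20 0 = e)
    (hg : Prescribes q m (s 7) (s 8) (s 9) g) (hinv : ItemInv G q (s 7) (s 8) (s 9) g t e s) :
    Run itemBody s 190 (ItemInv G q (s 7) (s 8) (s 9) g t (e + 1)) := by
  obtain ⟨i1, i2, i3⟩ := hinv
  obtain ⟨hadj, hc⟩ := hs.adj e he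
  refine Run.seq 8 182 (by omega) (Run.write (by decide) ?_)
  refine Run.branch 170 (by decide) (fun h => ?_) (fun h => Run.skip (by omega) ?_)
  · simp [Expr.val, hs.words] at h
    refine Run.seq 10 160 (by omega) (Run.write (by decide) ?_)
    obtain ⟨hun, hvn, -⟩ := id hadj
    refine (run_placeItem (n := n) (e := e) (u := s 7 e) (v := s 8 e) (c := s 9 e)
      (by simpa using hse) (by simp) (by simp) (by simp) hc hun hvn hadj.ne
      (by simpa using i2)).monoFrame (by omega) ?_
    rintro s' hf ⟨a1, a2⟩
    have h17 : s' 17 0 = s 17 0 + s 17 0 - 2 ^ m := by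
      rw [hf 17 (by decide)]
      simp [Expr.val, hs.words]
    have h16 : s' 16 = tryEdge (s 16) (s 7 e) (s 8 e) (s 9 e) := by
      rw [a1]; simp
    refine ⟨?_, a2, fun ht => ?_⟩
    · rw [h16]
      exact i1.tryEdge (fun _ _ h => h.symm) (fun _ _ h => h.ne) hc hadj
    · obtain ⟨j1, j2, j3⟩ := i3 ht
      have htake : q (2 * s 7 e + s 9 e) = s 8 e + 1 := by
        by_contra hne
        have := hg.leave e he hne
        have := hg.lt (e + 1) he
        omega
      have := hg.take e he htake
      obtain ⟨b1, b2⟩ := tryEdge_subtable (fun _ _ h => h.ne) i1 hq hc j2 htake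
      rw [h16]
      refine ⟨by omega, b2, fun i hi hqi => ?_⟩
      rcases Nat.lt_succ_iff_lt_or_eq.1 hi with h' | rfl
      · have := j3 i h' hqi
        rw [tryEdge_of_ne_zero (by omega), this]
      · exact b1
  · simp [Expr.val, hs.words] at h
    refine ⟨by simpa using i1, by simpa using i2, fun ht => ?_⟩
    obtain ⟨j1, j2, j3⟩ := i3 ht
    have hleave : q (2 * s 7 e + s 9 e) ≠ s 8 e + 1 := by
      intro heq
      have := hg.take e he heq
      omega
    have := hg.leave e he hleave
    refine ⟨by simp [Expr.val]; omega, by simpa using j2, fun i hi hqi => ?_⟩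
    rcases Nat.lt_succ_iff_lt_or_eq.1 hi with h' | rfl
    · simpa using j3 i h' hqi
    · exact absurd hqi hleave

/-- Try the set of items that is given by the word `19`. -/
def tryWord : Program :=
  .seq clearTable (.seq (.assign 15 (.const 0)) (.seq (.assign 17 (.var 19))
    (.seq (.for 20 6 itemBody)
      (.branch (.minus (.var 15) (.var 14)) (.seq (.assign 14 (.var 15)) output) .skip))))

/-- Try all sets of items. -/
def search : Program := .for 19 10 tryWord

/-- The state of the search before the word `r`, where `q` is the table that belongs to the
word `a`. -/
def SearchInv {n : ℕ} (G : SimpleGraph (Fin n)) (q : ℕ → ℕ) (a r : ℕ) (s : Store) : Prop :=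
  IsTable G.AdjNat (s 16) ∧ (∃ p, IsTable G.AdjNat p ∧ s 14 0 = (usedCells n p).card ∧
    ∀ u v, u < n → v < n → s 2 (u * n + v) = tableEntry p u v) ∧
    (a < r → (usedCells n q).card ≤ s 14 0)

theorem run_tryWord {n m r : ℕ} {G : SimpleGraph (Fin n)} {q g : ℕ → ℕ} {s : Store}
    (hG : HoldsGraph G s) (h18 : s 18 0 = 2 * n) (hs : HoldsItems G m s) (hr : s 19 0 = r)
    (hq : IsTable G.AdjNat q)
    (hcov : ∀ u v c, c < 2 → q (2 * u + c) = v + 1 → Listed s u v c ∨ Listed s v u c)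
    (hg : Prescribes q m (s 7) (s 8) (s 9) g) (hinv : SearchInv G q (g 0) r s) :
    Run tryWord s (n * n * 92 + n * 55 + m * 202 + 100) (SearchInv G q (g 0) (r + 1)) := by
  obtain ⟨i1, ⟨p, hp, i2, i3⟩, i4⟩ := hinv
  refine Run.seq (2 * n * 17 + 9) (n * n * 92 + n * 21 + m * 202 + 91) (by omega)
    ((run_clearTable h18 fun k hk => i1.eq_zero hk).monoFrame le_rfl ?_)
  intro s₁ hf₁ h16
  refine Run.seq 5 (n * n * 92 + n * 21 + m * 202 + 86) (by omega) (Run.write (by decide) ?_)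
  refine Run.seq 5 (n * n * 92 + n * 21 + m * 202 + 81) (by omega) (Run.write (by decide) ?_)
  set s₂ := Function.update s₁ 15 (Function.update (s₁ 15) ((const 0).val s₁) ((const 0).val s₁))
    with hs₂
  set s₃ := Function.update s₂ 17 (Function.update (s₂ 17) ((const 0).val s₂) ((var 19).val s₂))
    with hs₃
  have hf₃ : ∀ a, a ∉ [15, 16, 17, 20] → s₃ a = s a := by
    intro a ha
    simp only [List.mem_cons, List.not_mem_nil, or_false, not_or] at ha
    rw [hs₃, Function.update_of_ne ha.2.2.1, hs₂, Function.update_of_ne ha.1]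
    exact hf₁ a (by simp [clearTable, Program.writes, Program.for, ha])
  have hs3 : HoldsItems G m s₃ := hs.congr (hf₃ 6 (by decide)) (hf₃ 7 (by decide))
    (hf₃ 8 (by decide)) (hf₃ 9 (by decide)) (hf₃ 10 (by decide))
  have e7 := hf₃ 7 (by decide)
  have e8 := hf₃ 8 (by decide)
  have e9 := hf₃ 9 (by decide)
  have e16 : s₃ 16 = fun _ => 0 := by simpa [s₃, s₂] using h16
  have e17 : s₃ 17 0 = r := by simp [s₃, s₂, Expr.val, hf₁ 19 (by decide), hr]
  refine Run.seq (m * 202 + 9) (n * n * 92 + n * 21 + 72) (by omega) (Run.for (N := m) (T := 190)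
    (ItemInv G q (s 7) (s 8) (s 9) g (r = g 0)) hs3.count le_rfl (by decide) (by decide) ?_ ?_ ?_ ?_)
  · intro k s x h
    simpa [ItemInv] using h
  · refine ⟨by rw [e16]; exact isTable_zero _, ?_, fun ht => ⟨by rw [e17, ht], ?_, by omega⟩⟩
    · rw [e16]; simp [s₃, s₂, Expr.val, usedCells]
    · rw [e16]; simp
  · intro e s₄ he hse hf hinv
    have h7 : s₄ 7 = s 7 := (hf 7 (by decide)).trans e7
    have h8 : s₄ 8 = s 8 := (hf 8 (by decide)).trans e8
    have h9 : s₄ 9 = s 9 := (hf 9 (by decide)).trans e9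
    rw [← h7, ← h8, ← h9] at hg hinv ⊢
    exact run_itemBody hq (hs3.congr (hf 6 (by decide)) (hf 7 (by decide)) (hf 8 (by decide))
      (hf 9 (by decide)) (hf 10 (by decide))) he hse hg hinv
  · rintro s₄ hf ⟨j1, j2, j3⟩
    have hfs : ∀ a, a ∉ [15, 16, 17, 20] → s₄ a = s a := by
      intro a ha
      refine (hf a ?_).trans (hf₃ a ha)
      simp only [List.mem_cons, List.not_mem_nil, or_false, not_or] at ha
      simp [itemBody, placeItem, Program.writes, ha]
    -- With the right word every listed item of `q` is present at the end. An edge of `q` may be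
    -- listed in one direction only; the symmetry of the tables then fills the opposite cell.
    have hle : r = g 0 → (usedCells n q).card ≤ s₄ 15 0 := by
      intro ht
      obtain ⟨-, k2, k3⟩ := j3 ht
      rw [j2]
      refine Finset.card_le_card fun k hk => ?_
      rw [mem_usedCells] at hk ⊢
      refine ⟨hk.1, ?_⟩
      have hL : ∀ u v c, Listed s u v c → q (2 * u + c) = v + 1 → s₄ 16 (2 * u + c) = v + 1 := by
        rintro u v c ⟨e, he, rfl, rfl, rfl⟩ h
        exact k3 e (hs.count ▸ he) h
      obtain ⟨v, hv⟩ := Nat.exists_eq_succ_of_ne_zero hk.2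
      have hd : 2 * (k / 2) + k % 2 = k := by omega
      have hv' := (hq.at hv).2
      rcases hcov (k / 2) v (k % 2) (by omega) (by rw [hd]; exact hv) with h | h
      · have := hL _ _ _ h (by rw [hd]; exact hv)
        rw [hd] at this
        omega
      · have := (j1 v (k % 2) (k / 2) (by omega) (hL _ _ _ h hv')).2.1
        rw [hd] at this
        omega
    refine Run.branch (n * n * 92 + n * 21 + 20) (by simp only [Expr.cost]; omega) (fun h => ?_)
      (fun h => Run.skip (by omega) ⟨j1, ⟨p, hp, ?_, ?_⟩, ?_⟩)
    · simp only [Expr.val] at h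
      refine Run.seq 6 (n * n * 92 + n * 21 + 9) (by omega) (Run.write (by decide) ?_)
      have := run_output (n := n) (s := Function.update s₄ 14
        (Function.update (s₄ 14) ((const 0).val s₄) ((var 15).val s₄)))
        (by simp [hfs 0 (by decide), hG.order])
        (by simpa [hfs 3 (by decide)] using hG.offset)
      refine this.monoFrame (by ring_nf; omega) ?_
      intro s₅ hf₅ hout
      have h16 : s₅ 16 = s₄ 16 := by rw [hf₅ 16 (by decide)]; simp
      have h14 : s₅ 14 0 = s₄ 15 0 := by rw [hf₅ 14 (by decide)]; simp [Expr.val]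
      refine ⟨by rw [h16]; exact j1, ⟨s₄ 16, j1, by rw [h14, j2], by simpa using hout⟩, ?_⟩
      intro hlt
      rw [h14]
      rcases Nat.lt_succ_iff_lt_or_eq.1 hlt with h' | h'
      · have := i4 h'
        rw [hfs 14 (by decide)] at h
        omega
      · exact hle h'.symm
    · rw [hfs 14 (by decide), i2]
    · rw [hfs 2 (by decide)]; exact i3
    · intro hlt
      simp only [Expr.val] at h
      rcases Nat.lt_succ_iff_lt_or_eq.1 hlt with h' | h'
      · rw [hfs 14 (by decide)]; exact i4 h'
      · have := hle h'.symm
        omega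

theorem run_search {n m : ℕ} {G : SimpleGraph (Fin n)} {q : ℕ → ℕ} {s : Store}
    (hG : HoldsGraph G s) (h18 : s 18 0 = 2 * n) (hs : HoldsItems G m s)
    (hq : IsTable G.AdjNat q)
    (hcov : ∀ u v c, c < 2 → q (2 * u + c) = v + 1 → Listed s u v c ∨ Listed s v u c)
    (h2 : s 2 = fun _ => 0) (h14 : s 14 0 = 0) (h16 : s 16 = fun _ => 0) :
    Run search s (2 ^ m * (n * n * 92 + n * 55 + m * 202 + 112) + 9) fun s' =>
      ∃ p, IsTable G.AdjNat p ∧ (usedCells n q).card ≤ (usedCells n p).card ∧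
        ∀ u v, u < n → v < n → s' 2 (u * n + v) = tableEntry p u v := by
  obtain ⟨g, hg⟩ := exists_prescribes q m (s 7) (s 8) (s 9)
  refine Run.for (N := 2 ^ m) (T := n * n * 92 + n * 55 + m * 202 + 100) (SearchInv G q (g 0))
    hs.words le_rfl (by decide) (by decide) ?_ ?_ ?_ ?_
  · intro k s x h
    simpa [SearchInv] using h
  · refine ⟨by rw [h16]; exact isTable_zero _, ⟨fun _ => 0, isTable_zero _, ?_, ?_⟩, by omega⟩
    · simp [h14, usedCells]
    · simp [h2, tableEntry]
  · intro r s₁ hr hsr hf hinv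
    have hL : Listed s₁ = Listed s := Listed.congr (hf 6 (by decide)) (hf 7 (by decide))
      (hf 8 (by decide)) (hf 9 (by decide))
    refine run_tryWord (hG.congr (hf 0 (by decide)) (hf 1 (by decide)) (hf 3 (by decide)))
      (by rw [hf 18 (by decide), h18]) (hs.congr (hf 6 (by decide)) (hf 7 (by decide))
      (hf 8 (by decide)) (hf 9 (by decide)) (hf 10 (by decide))) hsr hq (by rw [hL]; exact hcov)
      ?_ hinv
    rw [hf 7 (by decide), hf 8 (by decide), hf 9 (by decide)]
    exact hg
  · rintro s' - ⟨-, ⟨p, hp, h1, h2⟩, h3⟩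
    -- The word `g 0` is below `2 ^ m`, so the loop has reached it.
    exact ⟨p, hp, h1 ▸ h3 (hg.lt 0 (by omega)), h2⟩

end RAM

/-! ### The whole algorithm and its time bound -/

namespace RAM

theorem holdsGraph_input {n : ℕ} (G : SimpleGraph (Fin n)) (i j : ℕ) (hi : i < n) (hj : j < n) :
    graphInput G 1 (i * n + j) ≠ 0 ↔ G.AdjNat i j := by
  simp only [graphInput, one_ne_zero, false_and, if_false, true_and]
  constructor
  · intro h
    obtain ⟨u, v, hadj, he⟩ : ∃ u v : Fin n, G.Adj u v ∧ i * n + j = u.val * n + v.val := by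
      by_contra h'
      exact h (if_neg fun h'' => h' h''.2)
    obtain ⟨rfl, rfl⟩ := flat_inj hj v.2 he
    exact ⟨u.2, v.2, hadj⟩
  · rintro ⟨_, _, h⟩
    rw [if_pos ⟨rfl, ⟨i, hi⟩, ⟨j, hj⟩, h, rfl⟩]
    exact one_ne_zero

theorem graphInput_eq_zero {n : ℕ} (G : SimpleGraph (Fin n)) {a : ℕ} (ha : 2 ≤ a) :
    graphInput G a = fun _ => 0 := by
  funext k
  rw [graphInput, if_neg (by omega), if_neg (by omega)]

/-- The algorithm: compute a vertex cover by a maximal matching, list boundedly many edges at each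
of its vertices, and search the sets of listed edges with colors. -/
def maxTwoEdgeColorable : Program :=
  .seq offsets (.seq greedyMatching (.seq listEdges search))

theorem run_maxTwoEdgeColorable {n : ℕ} (G : SimpleGraph (Fin n)) :
    Run maxTwoEdgeColorable (graphInput G)
      (800 * 2 ^ (64 * (G.matchingNumber * G.matchingNumber) + 8 * G.matchingNumber) * (n * n + 1))
      fun s => ∃ p, IsTable G.AdjNat p ∧
        (∀ q, IsTable G.AdjNat q → (usedCells n q).card ≤ (usedCells n p).card) ∧
        ∀ u v, u < n → v < n → s 2 (u * n + v) = tableEntry p u v := by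
  set ν := G.matchingNumber
  have hn : graphInput G 0 0 = n := by simp [graphInput]
  have h0 : ∀ a, 2 ≤ a → graphInput G a = fun _ => 0 := fun a ha => graphInput_eq_zero G ha
  have key : ∃ m ≤ 32 * (ν * ν) + 4 * ν, Run maxTwoEdgeColorable (graphInput G)
      ((n * 40 + 40) + ((n * (n * 72 + 21) + 20) + ((n * (n * 142 + 40) + 20) +
        (2 ^ m * (n * n * 92 + n * 55 + m * 202 + 112) + 9))))
      fun s => ∃ p, IsTable G.AdjNat p ∧
        (∀ q, IsTable G.AdjNat q → (usedCells n q).card ≤ (usedCells n p).card) ∧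
        ∀ u v, u < n → v < n → s 2 (u * n + v) = tableEntry p u v := by
    obtain ⟨t₁, s₁, r₁, ht₁, h18, hoff⟩ := run_offsets hn (by rw [h0 22 (by omega)])
    have hf₁ := r₁.frame
    have hG₁ : HoldsGraph G s₁ :=
      ⟨by rw [hf₁ 0 (by decide), hn], by rw [hf₁ 1 (by decide)]; exact holdsGraph_input G, hoff⟩
    obtain ⟨t₂, s₂, r₂, ht₂, ⟨μ, hK, hμ⟩, hX⟩ := run_greedyMatching hG₁
      (by rw [hf₁ 4 (by decide), h0 4 (by omega)])
    have hf₂ := r₂.frame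
    have hG₂ := hG₁.congr (hf₂ 0 (by decide)) (hf₂ 1 (by decide)) (hf₂ 3 (by decide))
    obtain ⟨t₃, s₃, r₃, ht₃, l1, l2, l3, l4⟩ := run_listEdges hG₂ hK
      (by rw [hf₂ 6 (by decide), hf₁ 6 (by decide), h0 6 (by omega)])
    have hf₃ := r₃.frame
    have hG₃ := hG₂.congr (hf₃ 0 (by decide)) (hf₃ 1 (by decide)) (hf₃ 3 (by decide))
    have hfr : ∀ a, 2 ≤ a → a ∉ offsets.writes → a ∉ greedyMatching.writes → a ∉ listEdges.writes →
        s₃ a = fun _ => 0 := fun a h b c d => by rw [hf₃ a d, hf₂ a c, hf₁ a b, h0 a h]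
    -- The optimal tables `p` and `q` occur in the analysis only; the program does not depend on
    -- them.
    obtain ⟨p, hp, hmax⟩ := exists_max_table G.AdjNat n
    obtain ⟨q, hq, hqc, hqL⟩ := hp.exists_listed (n := n) (fun _ _ h => h.symm)
      (fun _ _ h => h.ne) (fun _ _ h => h.1) (X := {u ∈ Finset.range n | s₂ 4 u ≠ 0}) (by
        intro u v huv
        have := hX u v huv
        obtain ⟨hu, hv, -⟩ := huv
        simpa [hu, hv] using this)
      -- An edge counts as listed only if it is listed with both colors, so that the exchange can
      -- keep the color.
      (L := fun u v => ∀ c < 2, Listed s₃ u v c) (fun u v h => (l2 u v 0 (h 0 two_pos)).1) (by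
        intro x hx
        rw [Finset.mem_filter, Finset.mem_range] at hx
        obtain ⟨d, S, rfl, h2, h3⟩ := l4 x hx.1 hx.2
        refine ⟨S, fun y hy => (h2 y hy).2, fun y hxy => ?_⟩
        rw [hμ.2]
        rcases h3 y hxy.2.1 hxy with h | h
        · exact Or.inl h
        · exact Or.inr (by omega))
    have hm : s₃ 6 0 ≤ 32 * (μ * μ) + 4 * μ := by
      refine l3.trans (le_of_eq ?_)
      rw [hμ.2]
      ring
    have hμν := hμ.le_matchingNumber
    refine ⟨s₃ 6 0, hm.trans (by gcongr), ?_⟩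
    obtain ⟨t₄, s₄, r₄, ht₄, p', hp', hle, hout⟩ := run_search hG₃
      (by rw [hf₃ 18 (by decide), hf₂ 18 (by decide), h18])
      ⟨rfl, l1, fun e he => l2 _ _ _ ⟨e, he, rfl, rfl, rfl⟩⟩ hq
      (fun u v c hc h => (hqL u c v hc h).imp (fun h => h c hc) (fun h => h c hc))
      (hfr 2 (by decide) (by decide) (by decide) (by decide))
      (by rw [hfr 14 (by decide) (by decide) (by decide) (by decide)])
      (hfr 16 (by decide) (by decide) (by decide) (by decide))
    exact ⟨_, s₄, .seq r₁ (.seq r₂ (.seq r₃ r₄)), by omega, p', hp',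
      fun r hr => (hmax r hr).trans (hqc ▸ hle), hout⟩
  obtain ⟨m, hm, h⟩ := key
  refine h.mono ?_ fun _ h => h
  -- The factor `m` in the cost of one trial is absorbed by a second factor `2 ^ m`, which doubles
  -- the exponent in the final bound.
  have hB : m + 1 ≤ 2 ^ m := Nat.lt_two_pow_self
  have hpow : 2 ^ m * 2 ^ m ≤ 2 ^ (64 * (ν * ν) + 8 * ν) := by
    rw [← pow_add]
    exact Nat.pow_le_pow_right two_pos (by omega)
  have hnn : n ≤ n * n := Nat.le_mul_self n
  generalize 2 ^ m = B at *
  have e1 : n * (n * 72 + 21) = n * n * 72 + n * 21 := by ring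
  have e2 : n * (n * 142 + 40) = n * n * 142 + n * 40 := by ring
  -- Here `461 = (92 + 55) + 202 + 112`, as `n ≤ n * n` and `m < B`.
  have e3 : n * n * 92 + n * 55 + m * 202 + 112 ≤ 461 * (B * (n * n + 1)) := by
    have : B * 1 ≤ B * (n * n + 1) := Nat.mul_le_mul_left _ (by omega)
    have : 1 * (n * n + 1) ≤ B * (n * n + 1) := Nat.mul_le_mul_right _ (by omega)
    omega
  have e4 : B * (n * n * 92 + n * 55 + m * 202 + 112) ≤ 461 * (B * B * (n * n + 1)) :=
    (Nat.mul_le_mul_left B e3).trans (le_of_eq (by ring))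
  have e5 : 1 * (n * n + 1) ≤ B * B * (n * n + 1) :=
    Nat.mul_le_mul_right _ (Nat.mul_pos (by omega) (by omega))
  have e6 := Nat.mul_le_mul_right (n * n + 1) hpow
  -- The phases before the search, with the final 9 steps, contribute at most `315 * (n * n + 1)`,
  -- and `461 + 315 ≤ 800`.
  rw [mul_assoc 800]
  omega

end RAM

theorem computable_timeBound :
    Computable fun k : ℕ => 800 * 2 ^ (64 * (k * k) + 8 * k) := by
  have hpow : Primrec₂ fun a b : ℕ => a ^ b := Primrec₂.unpaired'.1 Nat.Primrec.pow
  have hsq : Primrec fun k : ℕ => 64 * (k * k) + 8 * k :=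
    Primrec.nat_add.comp
      (Primrec.nat_mul.comp (Primrec.const 64) (Primrec.nat_mul.comp Primrec.id Primrec.id))
      (Primrec.nat_mul.comp (Primrec.const 8) Primrec.id)
  exact (Primrec.nat_mul.comp (Primrec.const 800) (hpow.comp (Primrec.const 2) hsq)).to_comp

theorem mainTheorem6 :
    maxTwoEdgeColorableSubgraph.IsFPT (fun I => I.2.matchingNumber) := by
  refine ⟨RAM.maxTwoEdgeColorable, _, computable_timeBound, Polynomial.X, ?_⟩
  rintro ⟨n, G⟩
  obtain ⟨t, s, hexec, ht, p, hp, hmax, hout⟩ := RAM.run_maxTwoEdgeColorable G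
  refine ⟨t, s, hexec, by simpa [maxTwoEdgeColorableSubgraph] using ht, ?_⟩
  obtain ⟨H, hHG, hcard, c, hc⟩ := hp.exists_coloring hout
  refine ⟨H, ⟨hHG, ⟨c⟩, fun H' hH' hcol => ?_⟩, c, hc⟩
  obtain ⟨q, hq, hqc⟩ := exists_table_of_edgeColorable hH' hcol
  -- Both edge numbers are compared through used cells, which count every edge twice.
  exact Nat.le_of_mul_le_mul_left ((hqc.symm.le.trans (hmax q hq)).trans hcard.symm.le) two_pos
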